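/- Proposition (Covariance ODE for the Shaped ReLU MLP). Fix inputs $x^1,\dots,x^m\in\mathbb{R}^{n_{\mathrm{in}}}$, constants $c_+,c_-\in\mathbb{R}$ and $p\in(0,\tfrac12)$. For width $n$ let $$\varphi_s(x)=s_+\max(x,0)+s_-\min(x,0),\qquad s_\pm=1+\frac{c_\pm}{n^p},\qquad c^{-1}=\mathbb{E}\,\varphi_s(g)^2\ \text{ for } g\sim N(0,1),$$ and consider the MLP with He initialization $$z_1^\alpha=\tfrac{1}{\sqrt{n_{\mathrm{in}}}}W_{\mathrm{in}}x^\alpha,\qquad z_{\ell+1}^\alpha=\sqrt{\tfrac{c}{n}}\,W_\ell\,\varphi_s(z_\ell^\alpha),\quad \ell\ge 1,$$ where $\varphi_s$ acts entrywise and all entries of $W_{\mathrm{in}}\in\mathbb{R}^{n\times n_{\mathrm{in}}}$ and $W_1,W_2,\ldots\in\mathbb{R}^{n\times n}$ are iid $N(0,1)$ (the recursion is continued to all $\ell$; the first $d$ layers are the hidden layers of the network of depth $d$). Put $V_0=\frac{1}{n_{\mathrm{in}}}[\langle x^\alpha,x^\beta\rangle]_{\alpha,\beta=1}^m$ and $V_\ell=\frac{c}{n}[\langle\varphi_s(z_\ell^\alpha),\varphi_s(z_\ell^\beta)\rangle]_{\alpha,\beta=1}^m$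 for $\ell\ge1$. For a positive semidefinite $m\times m$ matrix $V$ let $$b(V)^{\alpha\beta}=\nu(\rho^{\alpha\beta})\sqrt{V^{\alpha\alpha}V^{\beta\beta}},\quad \rho^{\alpha\beta}=\frac{V^{\alpha\beta}}{\sqrt{V^{\alpha\alpha}V^{\beta\beta}}},\quad \nu(\rho)=\frac{(c_+-c_-)^2}{2\pi}\left(\sqrt{1-\rho^2}-\rho\arccos\rho\right),$$ with $b(V)^{\alpha\beta}=0$ if $V^{\alpha\alpha}V^{\beta\beta}=0$. (1) The ODE $dV_t=b(V_t)\,dt$ with initial value $V_0$ has exactly one solution $(V_t)_{t\ge0}$ in the positive semidefinite matrices. Let $n,d\to\infty$ along any sequence with $d/n^{2p}\to1$. Then the upper triangular entries of the process $(V_{\lfloor td\rfloor})_{t\ge0}$, and likewise those of $(V_{\lfloor tn^{2p}\rfloor})_{t\ge0}$, converge weakly, in the Skorokhod space $D([0,\infty),\mathbb{R}^{m(m+1)/2})$ with the $J_1$ topology, to the upper triangular entries of the deterministic path $(V_t)_{t\ge 0}$. (2) Let $r(V)^{\alpha\beta}=\frac12 f(\rho^{\alpha\beta})\sqrt{V^{\alpha\alpha}V^{\beta\beta}}$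 (and $0$ if $V^{\alpha\alpha}V^{\beta\beta}=0$) with $f(\rho)=\frac1\pi\left(\rho\arcsin\rho+\sqrt{1-\rho^2}\right)+\frac12\rho$ be the drift of the infinite-depth-and-width ResNet covariance ODE $dU_t=r(U_t)\,dt$. Then $b(V)=(c_+-c_-)^2\left(r(V)-\frac12V\right)$ for every positive semidefinite $V$. In particular, if $(c_+-c_-)^2=1$, the two ODEs coincide up to the scalar normalization $e^{-t/2}$: a path $(U_t)_{t\ge0}$ of positive semidefinite matrices solves the ResNet ODE with $U_0=V_0$ if and only if $(e^{-t/2}U_t)_{t\ge0}$ solves $dV_t=b(V_t)\,dt$ with initial value $V_0$; hence both have the same correlations. -/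

import Mathlib

open Set Filter Topology MeasureTheory ProbabilityTheory
open scoped NNReal Matrix

noncomputable section

/-! ### The Skorokhod space `D([0,∞), E)` -/

/-- Càdlàg paths `[0,∞) → E`: right-continuous with left limits. -/
def IsCadlag {E : Type*} [TopologicalSpace E] (f : ℝ≥0 → E) : Prop :=
  ∀ t, ContinuousWithinAt f (Ici t) t ∧ ∃ l, Tendsto f (𝓝[<] t) (𝓝 l)

/-- The space `D([0,∞), E)` of càdlàg paths. -/
def SkorokhodSpace (E : Type*) [TopologicalSpace E] : Type _ :=
  {f : ℝ≥0 → E // IsCadlag f}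

namespace SkorokhodSpace

variable {E : Type*} [PseudoMetricSpace E]

/-- The basic Skorokhod neighbourhood of `f`: the paths `g` for which some increasing
homeomorphism `τ` of `[0,∞)` satisfies `|τ t - t| < ε` for all `t` and
`dist (g (τ t)) (f t) < ε` for all `t ≤ T`. -/
def nbhd (f : SkorokhodSpace E) (T ε : ℝ≥0) : Set (SkorokhodSpace E) :=
  {g | ∃ τ : ℝ≥0 ≃o ℝ≥0, (∀ t, dist (τ t) t < ε) ∧ ∀ t ≤ T, dist (g.1 (τ t)) (f.1 t) < ε}

theorem nbhd_mono (f : SkorokhodSpace E) {T T' ε ε' : ℝ≥0} (hT : T' ≤ T) (hε : ε ≤ ε') :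
    f.nbhd T ε ⊆ f.nbhd T' ε' := by
  rintro g ⟨τ, h1, h2⟩
  have hε' : (ε : ℝ) ≤ ε' := by exact_mod_cast hε
  exact ⟨τ, fun t => (h1 t).trans_le hε', fun t ht => (h2 t (ht.trans hT)).trans_le hε'⟩

/-- The Skorokhod `J₁` topology. It is the topology in which `g k → f` iff there are increasing
homeomorphisms `τ k` of `[0,∞)` with `sup_t |τ k t - t| → 0` and
`sup_{t ≤ T} dist (g k (τ k t)) (f t) → 0` for every `T`. -/
instance : TopologicalSpace (SkorokhodSpace E) where
  IsOpen U := ∀ f ∈ U, ∃ T ε : ℝ≥0, 0 < ε ∧ f.nbhd T ε ⊆ U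
  isOpen_univ := fun _ _ => ⟨0, 1, one_pos, subset_univ _⟩
  isOpen_inter := by
    rintro U V hU hV f ⟨hfU, hfV⟩
    obtain ⟨T, ε, hε, h⟩ := hU f hfU
    obtain ⟨T', ε', hε', h'⟩ := hV f hfV
    exact ⟨max T T', min ε ε', lt_min hε hε', subset_inter
      ((f.nbhd_mono (le_max_left _ _) (min_le_left _ _)).trans h)
      ((f.nbhd_mono (le_max_right _ _) (min_le_right _ _)).trans h')⟩
  isOpen_sUnion := by
    rintro S hS f ⟨U, hU, hfU⟩
    obtain ⟨T, ε, hε, h⟩ := hS U hU f hfU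
    exact ⟨T, ε, hε, h.trans (subset_sUnion_of_mem hU)⟩

instance : MeasurableSpace (SkorokhodSpace E) := borel _

instance : BorelSpace (SkorokhodSpace E) := ⟨rfl⟩

end SkorokhodSpace

theorem isCadlag_step {E : Type*} [TopologicalSpace E] (v : ℕ → E) (s : ℝ≥0) :
    IsCadlag (fun t : ℝ≥0 => v ⌊t * s⌋₊) := by
  have hc : Continuous fun u : ℝ≥0 => u * s := by fun_prop
  intro t
  constructor
  · refine (continuousWithinAt_const (b := v ⌊t * s⌋₊)).congr_of_eventuallyEq ?_ rfl
    have h : ∀ᶠ u in 𝓝[≥] t, u * s < (⌊t * s⌋₊ : ℝ≥0) + 1 :=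
      nhdsWithin_le_nhds (hc.continuousAt.eventually_lt_const (Nat.lt_floor_add_one _))
    filter_upwards [h, self_mem_nhdsWithin] with u hu htu
    have h1 : ⌊u * s⌋₊ = ⌊t * s⌋₊ := by
      rw [Nat.floor_eq_iff zero_le]
      exact ⟨(Nat.floor_le zero_le).trans (mul_le_mul_left htu s), hu⟩
    rw [h1]
  · obtain ⟨N, hN⟩ : ∃ N : ℕ, ∀ᶠ u in 𝓝[<] t, ⌊u * s⌋₊ = N := by
      rcases Nat.eq_zero_or_pos ⌈t * s⌉₊ with h0 | h0
      · refine ⟨0, ?_⟩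
        filter_upwards [self_mem_nhdsWithin] with u hu
        have h1 : t * s ≤ 0 := Nat.ceil_eq_zero.1 h0
        have h2 : u * s ≤ 0 := (mul_le_mul_left (le_of_lt hu) s).trans h1
        rw [le_zero_iff.1 h2, Nat.floor_zero]
      · obtain ⟨N, h1⟩ : ∃ N, ⌈t * s⌉₊ = N + 1 := ⟨_, (Nat.succ_pred_eq_of_pos h0).symm⟩
        obtain ⟨h2, h3⟩ := (Nat.ceil_eq_iff (Nat.succ_ne_zero N)).1 h1

        refine ⟨N, ?_⟩
        have hs : 0 < s := by
          rcases eq_or_ne s 0 with rfl | hs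
          · simp at h0
          · exact pos_iff_ne_zero.2 hs
        have h : ∀ᶠ u in 𝓝[<] t, (N : ℝ≥0) < u * s :=
          nhdsWithin_le_nhds (hc.continuousAt.eventually_const_lt h2)
        filter_upwards [h, self_mem_nhdsWithin] with u hu hut
        rw [Nat.floor_eq_iff zero_le]
        refine ⟨hu.le, lt_of_lt_of_le (mul_lt_mul_of_pos_right hut hs) ?_⟩
        exact_mod_cast h3
    exact ⟨v N, tendsto_const_nhds.congr' (hN.mono fun u hu => by simp only [hu])⟩

/-- The time-rescaled path `t ↦ v ⌊t s⌋` of a sequence `v`. -/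
def stepPath {E : Type*} [TopologicalSpace E] (s : ℝ≥0) (v : ℕ → E) : SkorokhodSpace E :=
  ⟨fun t => v ⌊t * s⌋₊, isCadlag_step v s⟩

/-! ### The shaped ReLU multilayer perceptron -/

/-- The shaped ReLU `φ_s(x) = s₊ max(x,0) + s₋ min(x,0)` with `s_± = 1 + c_± / n^p`. -/
def shapedReLU (cp cm p : ℝ) (n : ℕ) (x : ℝ) : ℝ :=
  (1 + cp / (n : ℝ) ^ p) * max x 0 + (1 + cm / (n : ℝ) ^ p) * min x 0

/-- The He constant `c`, given by `c⁻¹ = 𝔼 φ(g)²` for `g ∼ N(0,1)`. -/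
def heConst (φ : ℝ → ℝ) : ℝ := (∫ g, φ g ^ 2 ∂(gaussianReal 0 1))⁻¹

/-- Index set of all weights of an MLP of input dimension `nin` and width `n`: the entries of
`W_in` and of the hidden matrices `W_1, W_2, …` (those of `W_ℓ` have second index `ℓ - 1`). -/
abbrev WeightIdx (nin n : ℕ) : Type := (Fin n × Fin nin) ⊕ (ℕ × Fin n × Fin n)

/-- The input matrix `W_in`. -/
def inputMatrix {nin n : ℕ} (w : WeightIdx nin n → ℝ) : Matrix (Fin n) (Fin nin) ℝ :=
  Matrix.of fun i j => w (Sum.inl (i, j))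

/-- The hidden matrix `W_{ℓ+1}`. -/
def hiddenMatrix {nin n : ℕ} (w : WeightIdx nin n → ℝ) (l : ℕ) : Matrix (Fin n) (Fin n) ℝ :=
  Matrix.of fun i j => w (Sum.inr (l, i, j))

/-- The pre-activations of the MLP with activation `φ` and input `x`:
`preact φ w x l` is `z_{l+1}`, where `z_1 = W_in x / √nin` and
`z_{l+1} = √(c/n) W_l φ(z_l)`. -/
def preact {nin n : ℕ} (φ : ℝ → ℝ) (w : WeightIdx nin n → ℝ) (x : EuclideanSpace ℝ (Fin nin)) :
    ℕ → Fin n → ℝ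
  | 0 => (1 / √(nin : ℝ)) • (inputMatrix w *ᵥ fun j => x j)
  | l + 1 => √(heConst φ / n) • (hiddenMatrix w l *ᵥ fun j => φ (preact φ w x l j))

/-- The covariance matrix of the inputs, `V_0 = (1/nin) [⟨x^α, x^β⟩]`. -/
def inputCov {m nin : ℕ} (x : Fin m → EuclideanSpace ℝ (Fin nin)) : Matrix (Fin m) (Fin m) ℝ :=
  Matrix.of fun α β => (1 / (nin : ℝ)) * inner ℝ (x α) (x β)

/-- The covariance matrices: `V_0` is the input covariance and
`V_l = (c/n) [⟨φ(z_l^α), φ(z_l^β)⟩]` for `l ≥ 1`. -/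
def layerCov {m nin n : ℕ} (φ : ℝ → ℝ) (w : WeightIdx nin n → ℝ)
    (x : Fin m → EuclideanSpace ℝ (Fin nin)) : ℕ → Matrix (Fin m) (Fin m) ℝ
  | 0 => inputCov x
  | l + 1 => Matrix.of fun α β =>
      (heConst φ / n) * ∑ i, φ (preact φ w (x α) l i) * φ (preact φ w (x β) l i)

/-- All weights are iid `N(0,1)`. -/
def IsStdGaussianInit {nin n : ℕ} {Ω : Type*} [MeasurableSpace Ω] (P : Measure Ω)
    (W : WeightIdx nin n → Ω → ℝ) : Prop :=
  iIndepFun W P ∧ ∀ i, HasLaw (W i) (gaussianReal 0 1) P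

/-- Positions on or above the diagonal of an `m × m` matrix. -/
abbrev UpperIdx (m : ℕ) : Type := {q : Fin m × Fin m // q.1 ≤ q.2}

/-- The upper triangular entries of a matrix, flattened to a vector. -/
def upperEntries {m : ℕ} (V : Matrix (Fin m) (Fin m) ℝ) : UpperIdx m → ℝ :=
  fun q => V q.1.1 q.1.2

/-- The time-rescaled covariance process `t ↦ V_⌊t s⌋` (upper triangular entries) of the
width-`n` shaped ReLU MLP with weights `w`. -/
def covProcess {m nin n : ℕ} (cp cm p : ℝ) (x : Fin m → EuclideanSpace ℝ (Fin nin)) (s : ℝ≥0)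
    (w : WeightIdx nin n → ℝ) : SkorokhodSpace (UpperIdx m → ℝ) :=
  stepPath s fun l => upperEntries (layerCov (shapedReLU cp cm p n) w x l)

/-! ### The limiting differential equations -/

/-- The correlation `ρ^{αβ} = V^{αβ} / √(V^{αα} V^{ββ})`. -/
def corr {m : ℕ} (V : Matrix (Fin m) (Fin m) ℝ) (α β : Fin m) : ℝ :=
  V α β / √(V α α * V β β)

/-- `ν(ρ) = (c₊ - c₋)² / (2π) (√(1-ρ²) - ρ arccos ρ)`. -/
def reluNu (cp cm ρ : ℝ) : ℝ :=
  (cp - cm) ^ 2 / (2 * Real.pi) * (√(1 - ρ ^ 2) - ρ * Real.arccos ρ)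

/-- The ReLU drift `b(V)^{αβ} = ν(ρ^{αβ}) √(V^{αα} V^{ββ})` of the neural covariance SDE
(it is `0` where `V^{αα} V^{ββ} = 0`). -/
def reluDrift {m : ℕ} (cp cm : ℝ) (V : Matrix (Fin m) (Fin m) ℝ) : Matrix (Fin m) (Fin m) ℝ :=
  Matrix.of fun α β => reluNu cp cm (corr V α β) * √(V α α * V β β)

/-- `f(ρ) = (1/π) (ρ arcsin ρ + √(1-ρ²)) + ρ/2`. -/
def resnetF (ρ : ℝ) : ℝ :=
  1 / Real.pi * (ρ * Real.arcsin ρ + √(1 - ρ ^ 2)) + ρ / 2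

/-- The drift `(1/2) (f(ρ^{αβ}) / ρ^{αβ}) V^{αβ}` of the ResNet covariance ODE, where
`V^{αβ} / ρ^{αβ}` stands for `√(V^{αα} V^{ββ})`. -/
def resnetDrift {m : ℕ} (V : Matrix (Fin m) (Fin m) ℝ) : Matrix (Fin m) (Fin m) ℝ :=
  Matrix.of fun α β => 1 / 2 * resnetF (corr V α β) * √(V α α * V β β)

/-- `V` solves `dV_t = b(V_t) dt` on `[0,∞)` with initial value `V₀`, within the covariance
(positive semidefinite) matrices. -/
def IsCovODESolution {m : ℕ} (b : Matrix (Fin m) (Fin m) ℝ → Matrix (Fin m) (Fin m) ℝ)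
    (V₀ : Matrix (Fin m) (Fin m) ℝ) (V : ℝ → Matrix (Fin m) (Fin m) ℝ) : Prop :=
  V 0 = V₀ ∧ (∀ t, 0 ≤ t → (V t).PosSemidef) ∧
    ∀ t, 0 ≤ t → ∀ α β, HasDerivWithinAt (fun r => V r α β) (b (V t) α β) (Ici 0) t

end

/-! Write the activation as `A x + B |x|`, with `A → 1` and `B = (c₊ - c₋) / (2 n^p)`. Given the
features `u`, `v` of two inputs, the next covariance is an average over `n` iid Gaussian rows. The
arc-cosine formula gives its conditional mean as `⟨u,v⟩ + B²/(A²+B²) (2/π) q G(⟨u,v⟩/q)`, where `q =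
|u||v|` and `G(ρ) = √(1-ρ²) - ρ arccos ρ` (`integral_absLin_mul_absLin`). Since `B²` is of order
`n^(-2p)`, one layer is an Euler step of size about `n^(-2p)` for the drift `b`. Its conditional
variance is `O(1/n)`, which over `n^(2p)` layers accumulates to `O(n^(2p-1))` and vanishes because
`p < 1/2`.

Because `G(1) = 0`, the drift leaves the diagonal alone. In the limit the variances are therefore
constant, `q` is frozen at its initial value, and the matrix equation decouples into scalar
equations `v' = C q G(v/q)`. `G` extends to a bounded Lipschitz function on `ℝ`, so each scalar
equation has exactly one global solution.

For two inputs of positive variance the squared error of the covariance triple is stopped once it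
reaches a threshold of at most `1`. Up to then the square roots are Lipschitz, and the expected
error satisfies `E' ≤ (1 + K/s) E + δ/s` with `δ → 0` (`lintegral_nextErr_le`). A discrete Gronwall
argument and Markov's inequality give uniform convergence in probability (`weightLaw_layerErr_le`).
An input of zero variance stays at zero.

Locally uniform convergence to a deterministic path gives weak convergence for `J₁`, with the
identity as time change. Positive semidefiniteness of the limit is inherited from the network
covariances (`IsCovFlow.posSemidef`). The ResNet comparison is `arccos = π/2 - arcsin`, together
with homogeneity of the drift and the integrating factor `e^(-t/2)`. -/

/-! ### The arc-cosine kernel -/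

/-- The function `√(1-ρ²) - ρ arccos ρ`. -/
noncomputable def arcKer (ρ : ℝ) : ℝ := √(1 - ρ ^ 2) - ρ * Real.arccos ρ

theorem arcKer_one : arcKer 1 = 0 := by simp [arcKer]

theorem continuous_arcKer : Continuous arcKer := by
  unfold arcKer
  have := Real.continuous_arccos
  fun_prop

theorem hasDerivAt_arcKer {x : ℝ} (h1 : -1 < x) (h2 : x < 1) :
    HasDerivAt arcKer (-Real.arccos x) x := by
  have hpos : 0 < 1 - x ^ 2 := by nlinarith
  have h := ((((hasDerivAt_id x).pow 2).const_sub 1).sqrt hpos.ne').sub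
    ((hasDerivAt_id x).mul (Real.hasDerivAt_arccos h1.ne' h2.ne))
  have hs : √(1 - x ^ 2) ≠ 0 := (Real.sqrt_pos.2 hpos).ne'
  refine h.congr_deriv ?_
  simp only [id, Pi.pow_apply]
  field_simp
  simp only [Nat.cast_ofNat]
  ring_nf

/-- In the derivative the singular terms at `±1` cancel, and what remains, `-arccos`, is bounded by
`π`. The mean value theorem then gives a Lipschitz bound up to the end points. -/
theorem abs_arcKer_sub_le {x y : ℝ} (hx : x ∈ Icc (-1 : ℝ) 1) (hy : y ∈ Icc (-1 : ℝ) 1) :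
    |arcKer x - arcKer y| ≤ Real.pi * |x - y| := by
  wlog hxy : x < y generalizing x y
  · rcases eq_or_lt_of_le (not_lt.1 hxy) with rfl | h
    · simp
    · rw [abs_sub_comm, abs_sub_comm x]; exact this hy hx h
  obtain ⟨z, hz, h⟩ := exists_hasDerivAt_eq_slope arcKer (fun x => -Real.arccos x) hxy
    continuous_arcKer.continuousOn
    fun z hz => hasDerivAt_arcKer (hx.1.trans_lt hz.1) (hz.2.trans_le hy.2)
  have hd : 0 < y - x := sub_pos.2 hxy
  rw [eq_div_iff hd.ne'] at h
  rw [abs_sub_comm, ← h, abs_sub_comm x, abs_mul, abs_neg, abs_of_nonneg (Real.arccos_nonneg z)]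
  exact mul_le_mul_of_nonneg_right (Real.arccos_le_pi z) (abs_nonneg _)

/-- `arcKer` extended from `[-1,1]` to `ℝ` by constants. -/
noncomputable def arcKerExt (ρ : ℝ) : ℝ := arcKer (projIcc (-1 : ℝ) 1 (by norm_num) ρ)

theorem arcKerExt_of_mem {ρ : ℝ} (h : |ρ| ≤ 1) : arcKerExt ρ = arcKer ρ := by
  rw [arcKerExt, projIcc_of_mem _ (abs_le.1 h)]

theorem arcKerExt_one : arcKerExt 1 = 0 := by rw [arcKerExt_of_mem (by simp), arcKer_one]

/-- The extension makes the drift globally Lipschitz, so the scalar equation can be solved without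
first knowing that correlations stay in `[-1,1]`. -/
theorem abs_arcKerExt_sub_le (x y : ℝ) : |arcKerExt x - arcKerExt y| ≤ Real.pi * |x - y| :=
  (abs_arcKer_sub_le (projIcc (-1 : ℝ) 1 _ x).2 (projIcc (-1 : ℝ) 1 _ y).2).trans
    (mul_le_mul_of_nonneg_left (abs_projIcc_sub_projIcc _) Real.pi_pos.le)

theorem abs_arcKerExt_le (x : ℝ) : |arcKerExt x| ≤ 2 * Real.pi := by
  have h1 := (projIcc (-1 : ℝ) 1 (by norm_num) x).2
  have h := abs_arcKer_sub_le h1 (show (1 : ℝ) ∈ Icc (-1 : ℝ) 1 by simp)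
  rw [arcKer_one, sub_zero] at h
  refine h.trans ?_
  rw [mul_comm]
  refine mul_le_mul_of_nonneg_right ?_ Real.pi_pos.le
  rw [abs_le]; constructor <;> linarith [h1.1, h1.2]

/-- The scalar drift `q G(c/q)`, with `G` the extended arc-cosine kernel. -/
noncomputable def pairDrift (q c : ℝ) : ℝ := q * arcKerExt (c / q)

/-- This is why variances are conserved: the kernel vanishes at correlation one. -/
theorem pairDrift_self (q : ℝ) : pairDrift q q = 0 := by
  rcases eq_or_ne q 0 with rfl | h
  · simp [pairDrift]
  · rw [pairDrift, div_self h, arcKerExt_one, mul_zero]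

theorem abs_pairDrift_le {q : ℝ} (hq : 0 ≤ q) (c : ℝ) : |pairDrift q c| ≤ 2 * Real.pi * q := by
  rw [pairDrift, abs_mul, abs_of_nonneg hq, mul_comm]
  exact mul_le_mul_of_nonneg_right (abs_arcKerExt_le _) hq

/-- The factor `q` cancels the `1/q` inside the kernel, so the constant does not depend on `q`. -/
theorem abs_pairDrift_sub_le (q : ℝ) (c c' : ℝ) :
    |pairDrift q c - pairDrift q c'| ≤ Real.pi * |c - c'| := by
  rcases eq_or_ne q 0 with rfl | h
  · simp only [pairDrift, zero_mul, sub_self, abs_zero]; positivity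
  · rw [pairDrift, pairDrift, ← mul_sub, abs_mul]
    refine (mul_le_mul_of_nonneg_left (abs_arcKerExt_sub_le _ _) (abs_nonneg q)).trans_eq ?_
    rw [← sub_div, abs_div]
    have := abs_pos.2 h
    field_simp

/-- In `q`, the constant `3π` is `2π` from the size of the kernel plus `π` from its Lipschitz
constant; the latter needs `|c/q| ≤ 1`, which is where `|c| ≤ q` enters. -/
theorem abs_pairDrift_sub_pairDrift_le {q q₀ c : ℝ} (c₀ : ℝ) (hq : 0 ≤ q) (hq₀ : 0 < q₀)
    (hc : |c| ≤ q) :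
    |pairDrift q c - pairDrift q₀ c₀| ≤ 3 * Real.pi * |q - q₀| + Real.pi * |c - c₀| := by
  have h1 : |pairDrift q c - pairDrift q₀ c| ≤ 3 * Real.pi * |q - q₀| := by
    rcases eq_or_lt_of_le hq with rfl | hq'
    · have hc0 : c = 0 := abs_nonpos_iff.1 hc
      subst hc0
      have := abs_pairDrift_le hq₀.le 0
      simp only [pairDrift, zero_mul, zero_sub, abs_neg] at this ⊢
      rw [abs_of_pos hq₀]
      nlinarith [Real.pi_pos]
    · have e : pairDrift q c - pairDrift q₀ c =
          (q - q₀) * arcKerExt (c / q) + q₀ * (arcKerExt (c / q) - arcKerExt (c / q₀)) := by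
        simp only [pairDrift]; ring
      have h2 : q₀ * |c / q - c / q₀| ≤ |q - q₀| := by
        have : c / q - c / q₀ = (c / q) * ((q₀ - q) / q₀) := by field_simp
        rw [this, abs_mul, abs_div (q₀ - q), abs_of_pos hq₀, abs_div, abs_of_pos hq',
          abs_sub_comm]
        have : |c| / q ≤ 1 := (div_le_one hq').2 hc
        calc q₀ * (|c| / q * (|q - q₀| / q₀)) = |c| / q * |q - q₀| := by field_simp
          _ ≤ 1 * |q - q₀| := mul_le_mul_of_nonneg_right this (abs_nonneg _)
          _ = _ := one_mul _
      rw [e]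
      refine (abs_add_le _ _).trans ?_
      rw [abs_mul, abs_mul, abs_of_pos hq₀]
      have h3 := mul_le_mul_of_nonneg_left (abs_arcKerExt_le (c / q)) (abs_nonneg (q - q₀))
      have h4 := mul_le_mul_of_nonneg_left (abs_arcKerExt_sub_le (c / q) (c / q₀)) hq₀.le
      have h5 := mul_le_mul_of_nonneg_left h2 Real.pi_pos.le
      linarith
  calc _ ≤ |pairDrift q c - pairDrift q₀ c| + |pairDrift q₀ c - pairDrift q₀ c₀| :=
        abs_sub_le _ _ _
    _ ≤ _ := add_le_add h1 (abs_pairDrift_sub_le _ _ _)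

theorem reluNu_eq (cp cm ρ : ℝ) : reluNu cp cm ρ = (cp - cm) ^ 2 / (2 * Real.pi) * arcKer ρ := rfl

/-! ### Scalar autonomous equations -/

theorem autonomous_unique {F : ℝ → ℝ} {K : ℝ≥0} (hF : LipschitzWith K F) {T : ℝ} {u v : ℝ → ℝ}
    (hu : ∀ t ∈ Icc 0 T, HasDerivWithinAt u (F (u t)) (Icc 0 T) t)
    (hv : ∀ t ∈ Icc 0 T, HasDerivWithinAt v (F (v t)) (Icc 0 T) t) (h0 : u 0 = v 0) :
    EqOn u v (Icc 0 T) := by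
  have key : ∀ w : ℝ → ℝ, (∀ t ∈ Icc 0 T, HasDerivWithinAt w (F (w t)) (Icc 0 T) t) →
      ∀ t ∈ Ico 0 T, HasDerivWithinAt w (F (w t)) (Ici t) t := fun w hw t ht =>
    ((hw t ⟨ht.1, ht.2.le⟩).mono (Icc_subset_Icc_left ht.1)).mono_of_mem_nhdsWithin
      (Icc_mem_nhdsGE ht.2)
  exact ODE_solution_unique (v := fun _ => F) (fun _ => hF)
    (fun t ht => (hu t ht).continuousWithinAt) (key u hu)
    (fun t ht => (hv t ht).continuousWithinAt) (key v hv) h0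

theorem autonomous_unique_Ici {F : ℝ → ℝ} {K : ℝ≥0} (hF : LipschitzWith K F) {u v : ℝ → ℝ}
    (hu : ∀ t, 0 ≤ t → HasDerivWithinAt u (F (u t)) (Ici 0) t)
    (hv : ∀ t, 0 ≤ t → HasDerivWithinAt v (F (v t)) (Ici 0) t) (h0 : u 0 = v 0) :
    EqOn u v (Ici 0) := fun _ hT =>
  autonomous_unique hF (fun t ht => (hu t ht.1).mono Icc_subset_Ici_self)
    (fun t ht => (hv t ht.1).mono Icc_subset_Ici_self) h0 ⟨hT, le_rfl⟩

/-- A bounded field cannot leave the ball of radius `B N` in time `N`, so Picard–Lindelöf works on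
every `[0,N]`; uniqueness glues the solutions together. -/
theorem autonomous_exists {F : ℝ → ℝ} {K : ℝ≥0} (hF : LipschitzWith K F) {B : ℝ≥0}
    (hB : ∀ x, |F x| ≤ B) (c : ℝ) :
    ∃ v : ℝ → ℝ, v 0 = c ∧ ∀ t, 0 ≤ t → HasDerivWithinAt v (F (v t)) (Ici 0) t := by
  have hloc : ∀ N : ℕ, ∃ α : ℝ → ℝ, α 0 = c ∧
      ∀ t ∈ Icc (0 : ℝ) N, HasDerivWithinAt α (F (α t)) (Icc (0 : ℝ) N) t := by
    intro N
    have hPL : IsPicardLindelof (fun _ => F) (tmin := 0) (tmax := N)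
        ⟨0, by simp⟩ c (B * N) 0 B K := by
      refine IsPicardLindelof.of_time_independent (fun x _ => hB x) hF.lipschitzOnWith ?_
      simp
    exact hPL.exists_eq_forall_mem_Icc_hasDerivWithinAt₀
  choose α hα0 hα using hloc
  have hagree : ∀ M N : ℕ, M ≤ N → EqOn (α M) (α N) (Icc (0 : ℝ) M) := fun M N hMN =>
    autonomous_unique hF (hα M) (fun t ht => by
      have hMN' : (M : ℝ) ≤ N := by exact_mod_cast hMN
      exact (hα N t ⟨ht.1, ht.2.trans hMN'⟩).mono (Icc_subset_Icc_right hMN'))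
      ((hα0 M).trans (hα0 N).symm)
  refine ⟨fun t => α ⌈t⌉₊ t, by simp [hα0], fun t ht => ?_⟩
  have hv : ∀ (N : ℕ) (r : ℝ), 0 ≤ r → r ≤ N → α ⌈r⌉₊ r = α N r := fun N r hr hrN =>
    hagree _ _ (Nat.ceil_le.2 hrN) ⟨hr, Nat.le_ceil r⟩
  -- The extra `1` gives a local solution living on both sides of `t`, even when `t` is an integer.
  have htN : t < ((⌈t⌉₊ + 1 : ℕ) : ℝ) := by push_cast; linarith [Nat.le_ceil t]
  set N := ⌈t⌉₊ + 1
  have h1 : HasDerivWithinAt (α N) (F (α N t)) (Ici 0) t :=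
    (hα N t ⟨ht, htN.le⟩).mono_of_mem_nhdsWithin (by
      rw [← Ici_inter_Iic]
      exact inter_mem_nhdsWithin _ (Iic_mem_nhds htN))
  show HasDerivWithinAt (fun t => α ⌈t⌉₊ t) (F (α ⌈t⌉₊ t)) (Ici 0) t
  rw [hv N t ht htN.le]
  refine h1.congr_of_eventuallyEq ?_ (hv N t ht htN.le)
  filter_upwards [self_mem_nhdsWithin, nhdsWithin_le_nhds (Iio_mem_nhds htN)] with r hr hr'
  exact hv N r hr (le_of_lt hr')

/-- Over a step of length `h` the solution moves by at most `B h`, so its derivative changes by at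
most `K B h`. -/
theorem abs_euler_error_le {F : ℝ → ℝ} {K B : ℝ≥0} (hF : LipschitzWith K F)
    (hB : ∀ x, |F x| ≤ B) {v : ℝ → ℝ}
    (hv : ∀ t, 0 ≤ t → HasDerivWithinAt v (F (v t)) (Ici 0) t) {t h : ℝ} (ht : 0 ≤ t)
    (hh : 0 ≤ h) : |v (t + h) - v t - h * F (v t)| ≤ K * B * h ^ 2 := by
  have hsub : Icc t (t + h) ⊆ Ici 0 := fun r hr => ht.trans hr.1
  have h1 : ∀ r ∈ Icc t (t + h), |v r - v t| ≤ B * h := by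
    intro r hr
    have := norm_image_sub_le_of_norm_deriv_le_segment' (f := v) (f' := fun r => F (v r)) (C := B)
      (a := t) (b := t + h) (fun r hr => (hv r (hsub hr)).mono hsub) (fun r _ => hB _) r hr
    rw [Real.norm_eq_abs] at this
    exact this.trans (mul_le_mul_of_nonneg_left (by linarith [hr.2]) B.2)
  have h2 := norm_image_sub_le_of_norm_deriv_le_segment' (f := fun r => v r - r * F (v t))
    (f' := fun r => F (v r) - 1 * F (v t)) (C := K * B * h) (a := t) (b := t + h)
    (fun r hr => ((hv r (hsub hr)).mono hsub).sub ((hasDerivWithinAt_id r _).mul_const _))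
    (fun r hr => by
      rw [one_mul, ← dist_eq_norm]
      refine (hF.dist_le_mul _ _).trans ?_
      rw [Real.dist_eq, mul_assoc]
      exact mul_le_mul_of_nonneg_left (h1 r ⟨hr.1, hr.2.le⟩) K.2)
    (t + h) ⟨by linarith, le_rfl⟩
  rw [Real.norm_eq_abs] at h2
  convert h2 using 1
  · congr 1; ring
  · ring

/-! ### Algebraic identities for the drifts -/

theorem reluNu_eq_resnetF (cp cm ρ : ℝ) :
    reluNu cp cm ρ = (cp - cm) ^ 2 * (1 / 2 * resnetF ρ - 1 / 2 * ρ) := by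
  have hpi := Real.pi_pos.ne'
  rw [reluNu, resnetF, Real.arccos_eq_pi_div_two_sub_arcsin]
  field_simp
  ring

/-- A principal `2 × 2` minor is nonnegative; a repeated index is harmless. -/
theorem Matrix.PosSemidef.sq_apply_le {m : ℕ} {V : Matrix (Fin m) (Fin m) ℝ} (hV : V.PosSemidef)
    (α β : Fin m) : V α β ^ 2 ≤ V α α * V β β := by
  have hsymm : V β α = V α β := by simpa using hV.isHermitian.apply α β
  have h := (hV.submatrix ![α, β]).det_nonneg
  rw [Matrix.det_fin_two] at h
  simp [hsymm] at h
  nlinarith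

theorem Matrix.PosSemidef.abs_apply_le {m : ℕ} {V : Matrix (Fin m) (Fin m) ℝ} (hV : V.PosSemidef)
    (α β : Fin m) : |V α β| ≤ √(V α α * V β β) :=
  Real.abs_le_sqrt (hV.sq_apply_le α β)

/-- In the degenerate case positive semidefiniteness forces the entry itself to vanish, so the
convention `x / 0 = 0` is consistent. -/
theorem Matrix.PosSemidef.corr_mul {m : ℕ} {V : Matrix (Fin m) (Fin m) ℝ} (hV : V.PosSemidef)
    (α β : Fin m) : corr V α β * √(V α α * V β β) = V α β := by
  rcases eq_or_ne (√(V α α * V β β)) 0 with h | h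
  · have := hV.abs_apply_le α β
    rw [h] at this
    rw [h, mul_zero, abs_nonpos_iff.1 this]
  · exact div_mul_cancel₀ _ h

theorem reluDrift_eq {m : ℕ} (cp cm : ℝ) {V : Matrix (Fin m) (Fin m) ℝ} (hV : V.PosSemidef) :
    reluDrift cp cm V = (cp - cm) ^ 2 • (resnetDrift V - (1 / 2 : ℝ) • V) := by
  ext α β
  have h := hV.corr_mul α β
  simp only [reluDrift, resnetDrift, Matrix.of_apply, Matrix.smul_apply, Matrix.sub_apply,
    smul_eq_mul, reluNu_eq_resnetF]
  linear_combination (-(cp - cm) ^ 2 / 2) * h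

theorem reluDrift_apply {m : ℕ} (cp cm : ℝ) {V : Matrix (Fin m) (Fin m) ℝ} (hV : V.PosSemidef)
    (α β : Fin m) : reluDrift cp cm V α β =
      (cp - cm) ^ 2 / (2 * Real.pi) * pairDrift (√(V α α * V β β)) (V α β) := by
  have h : |corr V α β| ≤ 1 := by
    rw [corr, abs_div, abs_of_nonneg (Real.sqrt_nonneg _)]
    exact div_le_one_of_le₀ (hV.abs_apply_le α β) (Real.sqrt_nonneg _)
  rw [reluDrift, Matrix.of_apply, reluNu_eq, ← arcKerExt_of_mem h, pairDrift, corr]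
  ring

/-- Correlations are scale invariant, hence the drift is homogeneous of degree one; this lets the
scalar factor `e^(-t/2)` pass through it. -/
theorem resnetDrift_smul {m : ℕ} {r : ℝ} (hr : 0 < r) (V : Matrix (Fin m) (Fin m) ℝ) :
    resnetDrift (r • V) = r • resnetDrift V := by
  ext α β
  have hs : √(r * V α α * (r * V β β)) = r * √(V α α * V β β) := by
    rw [show r * V α α * (r * V β β) = r ^ 2 * (V α α * V β β) by ring,
      Real.sqrt_mul (sq_nonneg r), Real.sqrt_sq hr.le]
  have hc : corr (r • V) α β = corr V α β := by
    simp only [corr, Matrix.smul_apply, smul_eq_mul, hs]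
    exact mul_div_mul_left _ _ hr.ne'
  simp only [resnetDrift, Matrix.of_apply, Matrix.smul_apply, smul_eq_mul, hs, hc]
  ring

theorem isCovODESolution_exp_smul_iff {m : ℕ} {cp cm : ℝ} (hc : (cp - cm) ^ 2 = 1)
    (V₀ : Matrix (Fin m) (Fin m) ℝ) (U : ℝ → Matrix (Fin m) (Fin m) ℝ) :
    IsCovODESolution resnetDrift V₀ U ↔
      IsCovODESolution (reluDrift cp cm) V₀ (fun t => Real.exp (-t / 2) • U t) := by
  have hexp : ∀ (a t : ℝ), HasDerivWithinAt (fun r => Real.exp (a * r)) (a * Real.exp (a * t))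
      (Ici 0) t := fun a t => by
    have := (((hasDerivAt_id t).const_mul a).exp).hasDerivWithinAt (s := Ici 0)
    simpa [mul_comm] using this
  have hneg : ∀ t : ℝ, Real.exp (-t / 2) = Real.exp ((-1 / 2) * t) := fun t => by congr 1; ring
  have hb : ∀ t, (Real.exp (-t / 2) • U t).PosSemidef → ∀ α β,
      reluDrift cp cm (Real.exp (-t / 2) • U t) α β =
        Real.exp (-t / 2) * (resnetDrift (U t) α β - 1 / 2 * U t α β) := fun t h α β => by
    rw [reluDrift_eq cp cm h, hc, one_smul, resnetDrift_smul (Real.exp_pos _)]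
    simp only [Matrix.sub_apply, Matrix.smul_apply, smul_eq_mul]
    ring
  constructor
  · rintro ⟨h0, hpsd, hd⟩
    have hpsd' : ∀ t, 0 ≤ t → (Real.exp (-t / 2) • U t).PosSemidef := fun t ht =>
      (hpsd t ht).smul (Real.exp_pos _).le
    refine ⟨by simp [h0], hpsd', fun t ht α β => ?_⟩
    rw [hb t (hpsd' t ht)]
    have := (hexp (-1 / 2) t).mul (hd t ht α β)
    simp only [Matrix.smul_apply, smul_eq_mul, hneg]
    refine this.congr_deriv ?_
    ring
  · rintro ⟨h0, hpsd, hd⟩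
    have hU : ∀ t, U t = Real.exp ((1 / 2) * t) • (Real.exp (-t / 2) • U t) := fun t => by
      rw [smul_smul, hneg, ← Real.exp_add]; ring_nf; simp
    refine ⟨by simpa using h0, fun t ht => ?_, fun t ht α β => ?_⟩
    · rw [hU t]
      exact (hpsd t ht).smul (Real.exp_pos _).le
    · have h := hd t ht α β
      rw [hb t (hpsd t ht)] at h
      have := (hexp (1 / 2) t).mul h
      simp only [Matrix.smul_apply, smul_eq_mul] at this
      have e : ∀ r, Real.exp ((1 / 2) * r) * Real.exp (-r / 2) = 1 := fun r => by
        rw [← Real.exp_add]; ring_nf; simp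
      refine (this.congr_of_mem (fun r _ => ?_) ht).congr_deriv ?_
      · rw [Pi.mul_apply, ← mul_assoc, e, one_mul]
      · linear_combination (1 / 2 * U t α β + (resnetDrift (U t) α β - 1 / 2 * U t α β)) * e t

/-! ### Gaussian vectors -/

/-- The standard Gaussian measure on `Fin N → ℝ`. -/
noncomputable abbrev gaussVec (N : ℕ) : Measure (Fin N → ℝ) :=
  Measure.pi fun _ => gaussianReal 0 1

theorem integral_cexp_dotProduct_gaussVec {N : ℕ} (t : Fin N → ℝ) :
    ∫ w, Complex.exp ((w ⬝ᵥ t : ℝ) * Complex.I) ∂(gaussVec N) =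
      Complex.exp (-((t ⬝ᵥ t : ℝ) : ℂ) / 2) := by
  have h := charFun_pi (E := fun _ : Fin N => ℝ) (μ := fun _ => gaussianReal 0 1)
    (WithLp.toLp 2 t)
  simp_rw [charFun_gaussianReal] at h
  rw [charFun_apply, integral_map (by fun_prop) (by fun_prop), ← Complex.exp_sum] at h
  convert h using 2
  · ext w
    simp [PiLp.inner_apply, dotProduct, mul_comm]
  · simp [dotProduct, Finset.sum_div, pow_two, neg_div]

/-- The law of a pair of linear functionals of a standard Gaussian vector depends only on their
Gram matrix. -/
theorem map_dotProduct_pair_gaussVec {N M : ℕ} {u u' : Fin N → ℝ} {v v' : Fin M → ℝ}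
    (h1 : u ⬝ᵥ u = v ⬝ᵥ v) (h2 : u' ⬝ᵥ u' = v' ⬝ᵥ v') (h3 : u ⬝ᵥ u' = v ⬝ᵥ v') :
    (gaussVec N).map (fun w => (w ⬝ᵥ u, w ⬝ᵥ u')) =
      (gaussVec M).map (fun w => (w ⬝ᵥ v, w ⬝ᵥ v')) := by
  have hm : ∀ (K : ℕ) (x x' : Fin K → ℝ), Measurable fun w : Fin K → ℝ => (w ⬝ᵥ x, w ⬝ᵥ x') := by
    intro K x x'
    unfold dotProduct
    fun_prop
  -- A functional on `ℝ²` applied to the pair is again a linear functional of `w`, so the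
  -- characteristic function sees `x` and `x'` only through their Gram matrix.
  have key : ∀ (K : ℕ) (x x' : Fin K → ℝ) (L : StrongDual ℝ (ℝ × ℝ)),
      charFunDual ((gaussVec K).map (fun w => (w ⬝ᵥ x, w ⬝ᵥ x'))) L =
        Complex.exp (-((L (1, 0) ^ 2 * (x ⬝ᵥ x) + 2 * L (1, 0) * L (0, 1) * (x ⬝ᵥ x') +
          L (0, 1) ^ 2 * (x' ⬝ᵥ x') : ℝ) : ℂ) / 2) := by
    intro K x x' L
    have hL : ∀ a b : ℝ, L (a, b) = L (1, 0) * a + L (0, 1) * b := fun a b => by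
      have : ((a, b) : ℝ × ℝ) = a • (1, 0) + b • (0, 1) := by simp
      rw [this, map_add, map_smul, map_smul, smul_eq_mul, smul_eq_mul]; ring
    rw [charFunDual_apply, integral_map (hm K x x').aemeasurable (by fun_prop)]
    have := integral_cexp_dotProduct_gaussVec (L (1, 0) • x + L (0, 1) • x')
    convert this using 4
    · congr 2
      rw [hL, dotProduct_add, dotProduct_smul, dotProduct_smul, smul_eq_mul, smul_eq_mul]
    · congr 2
      simp only [dotProduct_add, add_dotProduct, dotProduct_smul, smul_dotProduct, smul_eq_mul]
      rw [dotProduct_comm x' x]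
      ring
  have : IsProbabilityMeasure ((gaussVec N).map (fun w => (w ⬝ᵥ u, w ⬝ᵥ u'))) :=
    Measure.isProbabilityMeasure_map (hm N u u').aemeasurable
  have : IsProbabilityMeasure ((gaussVec M).map (fun w => (w ⬝ᵥ v, w ⬝ᵥ v'))) :=
    Measure.isProbabilityMeasure_map (hm M v v').aemeasurable
  refine Measure.ext_of_charFunDual ?_
  ext L
  rw [key, key, h1, h2, h3]

theorem measurable_dotProduct_right {N : ℕ} (u : Fin N → ℝ) :
    Measurable fun w : Fin N → ℝ => w ⬝ᵥ u := by
  unfold dotProduct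
  fun_prop

theorem integral_pair_gaussVec_congr {N M : ℕ} {u u' : Fin N → ℝ} {v v' : Fin M → ℝ}
    (h1 : u ⬝ᵥ u = v ⬝ᵥ v) (h2 : u' ⬝ᵥ u' = v' ⬝ᵥ v') (h3 : u ⬝ᵥ u' = v ⬝ᵥ v') {f : ℝ × ℝ → ℝ}
    (hf : Measurable f) :
    ∫ w, f (w ⬝ᵥ u, w ⬝ᵥ u') ∂(gaussVec N) = ∫ w, f (w ⬝ᵥ v, w ⬝ᵥ v') ∂(gaussVec M) := by
  rw [← integral_map (φ := fun w => (w ⬝ᵥ u, w ⬝ᵥ u'))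
      ((measurable_dotProduct_right u).prodMk (measurable_dotProduct_right u')).aemeasurable
      hf.aestronglyMeasurable, map_dotProduct_pair_gaussVec h1 h2 h3,
    integral_map ((measurable_dotProduct_right v).prodMk
      (measurable_dotProduct_right v')).aemeasurable hf.aestronglyMeasurable]

theorem map_dotProduct_gaussVec {N : ℕ} (u : Fin N → ℝ) :
    (gaussVec N).map (fun w => w ⬝ᵥ u) = (gaussianReal 0 1).map (fun x => √(u ⬝ᵥ u) * x) := by
  have h0 : 0 ≤ u ⬝ᵥ u := Finset.sum_nonneg fun i _ => mul_self_nonneg _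
  -- Compare with a one-dimensional vector of the same length.
  have h := map_dotProduct_pair_gaussVec (u := u) (u' := u) (v := ![√(u ⬝ᵥ u)])
    (v' := ![√(u ⬝ᵥ u)]) (by simp [h0]) (by simp [h0]) (by simp [h0])
  have h' := congrArg (fun μ => μ.map Prod.fst) h
  rw [Measure.map_map measurable_fst
      ((measurable_dotProduct_right _).prodMk (measurable_dotProduct_right _)),
    Measure.map_map measurable_fst
      ((measurable_dotProduct_right _).prodMk (measurable_dotProduct_right _))] at h'
  refine h'.trans ?_
  have := (measurePreserving_eval (fun _ : Fin 1 => gaussianReal 0 1) 0).map_eq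
  rw [← this, Measure.map_map (by fun_prop) (by fun_prop)]
  congr 1
  ext w
  simp [dotProduct, mul_comm]

theorem memLp_dotProduct_gaussVec {N : ℕ} (u : Fin N → ℝ) {p : ENNReal} (hp : p ≠ ⊤) :
    MemLp (fun w => w ⬝ᵥ u) p (gaussVec N) := by
  have h : MemLp id p ((gaussVec N).map (fun w => w ⬝ᵥ u)) := by
    rw [map_dotProduct_gaussVec, memLp_map_measure_iff (by fun_prop) (by fun_prop)]
    exact (memLp_id_gaussianReal' p hp).const_mul _
  exact (memLp_map_measure_iff (by fun_prop) (measurable_dotProduct_right u).aemeasurable).1 h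

theorem integral_dotProduct_pow_gaussVec {N : ℕ} (u : Fin N → ℝ) (k : ℕ) :
    ∫ w, (w ⬝ᵥ u) ^ k ∂(gaussVec N) = √(u ⬝ᵥ u) ^ k * ∫ x, x ^ k ∂(gaussianReal 0 1) := by
  rw [← integral_map (φ := fun w => w ⬝ᵥ u) (f := fun x : ℝ => x ^ k)
    (measurable_dotProduct_right u).aemeasurable (by fun_prop), map_dotProduct_gaussVec,
    integral_map (by fun_prop) (by fun_prop), ← integral_const_mul]
  simp_rw [mul_pow]

theorem integral_sq_gaussianReal : ∫ x, x ^ 2 ∂(gaussianReal 0 1) = 1 := by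
  have h := variance_eq_sub (memLp_id_gaussianReal (μ := 0) (v := 1) 2)
  rw [variance_id_gaussianReal] at h
  simpa [integral_id_gaussianReal] using h.symm

theorem integral_dotProduct_sq_gaussVec {N : ℕ} (u : Fin N → ℝ) :
    ∫ w, (w ⬝ᵥ u) ^ 2 ∂(gaussVec N) = u ⬝ᵥ u := by
  rw [integral_dotProduct_pow_gaussVec, integral_sq_gaussianReal, mul_one, Real.sq_sqrt]
  exact Finset.sum_nonneg fun i _ => mul_self_nonneg _

theorem integrable_dotProduct_mul_gaussVec {N : ℕ} (u v : Fin N → ℝ) :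
    Integrable (fun w => (w ⬝ᵥ u) * (w ⬝ᵥ v)) (gaussVec N) :=
  (memLp_dotProduct_gaussVec u (p := 2) ENNReal.ofNat_ne_top).integrable_mul
    (memLp_dotProduct_gaussVec v (p := 2) ENNReal.ofNat_ne_top)

theorem integral_dotProduct_mul_gaussVec {N : ℕ} (u v : Fin N → ℝ) :
    ∫ w, (w ⬝ᵥ u) * (w ⬝ᵥ v) ∂(gaussVec N) = u ⬝ᵥ v := by
  have hi : ∀ x : Fin N → ℝ, Integrable (fun w => (w ⬝ᵥ x) ^ 2) (gaussVec N) :=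
    fun x => (memLp_dotProduct_gaussVec x ENNReal.ofNat_ne_top).integrable_sq
  -- Polarization.
  have h : ∀ w : Fin N → ℝ, (w ⬝ᵥ u) * (w ⬝ᵥ v) =
      ((w ⬝ᵥ (u + v)) ^ 2 - (w ⬝ᵥ (u - v)) ^ 2) / 4 := fun w => by
    rw [dotProduct_add, dotProduct_sub]; ring
  simp_rw [h]
  rw [integral_div, integral_sub (hi _) (hi _), integral_dotProduct_sq_gaussVec,
    integral_dotProduct_sq_gaussVec]
  simp only [dotProduct_add, dotProduct_sub, add_dotProduct, sub_dotProduct]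
  rw [dotProduct_comm v u]
  ring

/-! ### The arc-cosine formula -/

/-- The planar Gaussian density is radial, so in polar coordinates a 2-homogeneous integrand splits
into a radial and an angular factor. -/
theorem integral_homogeneous_gaussian_prod (h : ℝ × ℝ → ℝ)
    (hh : ∀ r θ, 0 < r → h (r * Real.cos θ, r * Real.sin θ) =
      r ^ 2 * h (Real.cos θ, Real.sin θ)) :
    ∫ p, h p ∂((gaussianReal 0 1).prod (gaussianReal 0 1)) =
      (∫ r in Ioi (0 : ℝ), r * ((2 * Real.pi)⁻¹ * Real.exp (-r ^ 2 / 2)) * r ^ 2) *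
        ∫ θ in Ioo (-Real.pi) Real.pi, h (Real.cos θ, Real.sin θ) := by
  rw [gaussianReal_of_var_ne_zero 0 one_ne_zero,
    prod_withDensity (measurable_gaussianPDF _ _) (measurable_gaussianPDF _ _),
    integral_withDensity_eq_integral_toReal_smul (by
      have := measurable_gaussianPDF 0 1
      fun_prop)
      (ae_of_all _ fun _ => ENNReal.mul_lt_top gaussianPDF_lt_top gaussianPDF_lt_top),
    ← Measure.volume_eq_prod, ← integral_comp_polarCoord_symm, polarCoord_target,
    Measure.volume_eq_prod, ← setIntegral_prod_mul]
  refine setIntegral_congr_fun (measurableSet_Ioi.prod measurableSet_Ioo) fun p hp => ?_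
  have hs : √(2 * Real.pi) * √(2 * Real.pi) = 2 * Real.pi := Real.mul_self_sqrt (by positivity)
  have he : Real.exp (-(p.1 * Real.cos p.2) ^ 2 / 2) * Real.exp (-(p.1 * Real.sin p.2) ^ 2 / 2) =
      Real.exp (-p.1 ^ 2 / 2) := by
    rw [← Real.exp_add]
    congr 1
    linear_combination (-p.1 ^ 2 / 2) * Real.sin_sq_add_cos_sq p.2
  simp only [polarCoord_symm_apply, ENNReal.toReal_mul, toReal_gaussianPDF, smul_eq_mul,
    gaussianPDFReal, hh p.1 p.2 hp.1, NNReal.coe_one, mul_one, sub_zero]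
  have hs' : (√(2 * Real.pi))⁻¹ * (√(2 * Real.pi))⁻¹ = (2 * Real.pi)⁻¹ := by rw [← mul_inv, hs]
  rw [← he, ← hs']
  ring

/-- The radial integral need not be computed: testing with `p.1² + p.2²`, of mean `2` and angular
integral `2π`, shows that it equals `1/π`. -/
theorem integral_homogeneous_gaussian_prod_eq (h : ℝ × ℝ → ℝ)
    (hh : ∀ r θ, 0 < r → h (r * Real.cos θ, r * Real.sin θ) =
      r ^ 2 * h (Real.cos θ, Real.sin θ)) :
    ∫ p, h p ∂((gaussianReal 0 1).prod (gaussianReal 0 1)) =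
      Real.pi⁻¹ * ∫ θ in (-Real.pi)..Real.pi, h (Real.cos θ, Real.sin θ) := by
  have hi : Integrable (fun x : ℝ => x ^ 2) (gaussianReal 0 1) :=
    (memLp_id_gaussianReal (μ := 0) (v := 1) 2).integrable_sq
  have h1 := integral_homogeneous_gaussian_prod (fun p => p.1 ^ 2 + p.2 ^ 2)
    (fun r θ _ => by ring)
  rw [integral_add (hi.comp_fst _) (hi.comp_snd _)] at h1
  simp only [Real.cos_sq_add_sin_sq] at h1
  have e1 := integral_fun_fst (μ := gaussianReal 0 1) (ν := gaussianReal 0 1)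
    (fun x : ℝ => x ^ 2)
  have e2 := integral_fun_snd (μ := gaussianReal 0 1) (ν := gaussianReal 0 1)
    (fun x : ℝ => x ^ 2)
  rw [e1, e2, integral_sq_gaussianReal] at h1
  rw [integral_homogeneous_gaussian_prod h hh, ← integral_Ioc_eq_integral_Ioo,
    ← intervalIntegral.integral_of_le (by linarith [Real.pi_pos])]
  congr 1
  have hpi := Real.pi_pos
  generalize (∫ r in Ioi (0 : ℝ), r * ((2 * Real.pi)⁻¹ * Real.exp (-r ^ 2 / 2)) * r ^ 2) = R at h1 ⊢
  simp at h1
  rw [max_eq_left (by linarith)] at h1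
  field_simp
  linarith

/-- The sign changes at `±(π - θ)`. Shifting the period to start at `-(π - θ)` leaves one interval
of each sign. -/
theorem integral_abs_cos_add_cos {θ : ℝ} (h0 : 0 ≤ θ) (h1 : θ ≤ Real.pi) :
    ∫ ψ in (-Real.pi)..Real.pi, |Real.cos ψ + Real.cos θ| =
      4 * Real.sin θ + (2 * Real.pi - 4 * θ) * Real.cos θ := by
  have hc : Continuous fun ψ => |Real.cos ψ + Real.cos θ| := by fun_prop
  have hper : Function.Periodic (fun ψ => |Real.cos ψ + Real.cos θ|) (2 * Real.pi) := fun ψ => by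
    simp only [Real.cos_add_two_pi]
  have hshift := hper.intervalIntegral_add_eq (-Real.pi) (-(Real.pi - θ))
  rw [show -Real.pi + 2 * Real.pi = Real.pi by ring,
    show -(Real.pi - θ) + 2 * Real.pi = Real.pi + θ by ring] at hshift
  have hF : ∀ a b : ℝ, ∫ ψ in a..b, (Real.cos ψ + Real.cos θ) =
      Real.sin b - Real.sin a + (b - a) * Real.cos θ := fun a b => by
    rw [intervalIntegral.integral_add (by simp) (by simp)]
    simp
  rw [hshift, ← intervalIntegral.integral_add_adjacent_intervals (b := Real.pi - θ)
    (hc.intervalIntegrable _ _) (hc.intervalIntegrable _ _)]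
  have e1 : ∫ ψ in (-(Real.pi - θ))..(Real.pi - θ), |Real.cos ψ + Real.cos θ| =
      ∫ ψ in (-(Real.pi - θ))..(Real.pi - θ), (Real.cos ψ + Real.cos θ) := by
    refine intervalIntegral.integral_congr fun ψ hψ => ?_
    rw [uIcc_of_le (by linarith)] at hψ
    refine abs_of_nonneg ?_
    have := Real.cos_le_cos_of_nonneg_of_le_pi (abs_nonneg ψ) (by linarith)
      (abs_le.2 ⟨by linarith [hψ.1], hψ.2⟩)
    rw [Real.cos_abs, Real.cos_pi_sub] at this
    linarith
  have e2 : ∫ ψ in (Real.pi - θ)..(Real.pi + θ), |Real.cos ψ + Real.cos θ| =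
      ∫ ψ in (Real.pi - θ)..(Real.pi + θ), -(Real.cos ψ + Real.cos θ) := by
    refine intervalIntegral.integral_congr fun ψ hψ => ?_
    rw [uIcc_of_le (by linarith)] at hψ
    refine abs_of_nonpos ?_
    have := Real.cos_le_cos_of_nonneg_of_le_pi (abs_nonneg (ψ - Real.pi)) h1
      (abs_le.2 ⟨by linarith [hψ.1], by linarith [hψ.2]⟩)
    rw [Real.cos_abs, Real.cos_sub_pi] at this
    linarith
  rw [e1, e2, intervalIntegral.integral_neg, hF, hF]
  simp only [Real.sin_neg, Real.sin_pi_sub, Real.sin_add, Real.sin_pi, Real.cos_pi]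
  ring

/-- By the product formula `cos ψ cos(θ - ψ) = (cos(2ψ - θ) + cos θ)/2`; the substitution `2ψ - θ`
then covers two periods. -/
theorem integral_abs_cos_mul_abs_cos_sub {θ : ℝ} (h0 : 0 ≤ θ) (h1 : θ ≤ Real.pi) :
    ∫ ψ in (-Real.pi)..Real.pi, |Real.cos ψ| * |Real.cos θ * Real.cos ψ + Real.sin θ * Real.sin ψ| =
      2 * Real.sin θ + (Real.pi - 2 * θ) * Real.cos θ := by
  set k : ℝ → ℝ := fun ψ => |Real.cos ψ + Real.cos θ| with hk
  have hc : Continuous k := by fun_prop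
  have hper : Function.Periodic k (2 * Real.pi) := fun ψ => by
    simp only [hk, Real.cos_add_two_pi]
  have e : ∀ ψ : ℝ, |Real.cos ψ| * |Real.cos θ * Real.cos ψ + Real.sin θ * Real.sin ψ| =
      1 / 2 * k (2 * ψ - θ) := fun ψ => by
    rw [← abs_mul, hk]
    simp only
    rw [← abs_of_pos (show (0 : ℝ) < 1 / 2 by norm_num), ← abs_mul]
    congr 1
    rw [Real.cos_sub, Real.cos_two_mul, Real.sin_two_mul]
    norm_num
    ring
  simp_rw [e]
  rw [intervalIntegral.integral_const_mul,
    intervalIntegral.integral_comp_mul_sub k (two_ne_zero) θ, smul_eq_mul]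
  have h2 : ∫ ψ in (2 * -Real.pi - θ)..(2 * Real.pi - θ), k ψ =
      2 * ∫ ψ in (-Real.pi)..Real.pi, k ψ := by
    rw [← intervalIntegral.integral_add_adjacent_intervals (b := -θ)
      (hc.intervalIntegrable _ _) (hc.intervalIntegrable _ _)]
    have a1 := hper.intervalIntegral_add_eq (2 * -Real.pi - θ) (-Real.pi)
    have a2 := hper.intervalIntegral_add_eq (-θ) (-Real.pi)
    rw [show -Real.pi + 2 * Real.pi = Real.pi by ring] at a1 a2
    rw [show 2 * -Real.pi - θ + 2 * Real.pi = -θ by ring] at a1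
    rw [show -θ + 2 * Real.pi = 2 * Real.pi - θ by ring] at a2
    rw [a1, a2]; ring
  rw [h2, integral_abs_cos_add_cos h0 h1]
  ring

theorem sq_dotProduct_le {N : ℕ} (u v : Fin N → ℝ) : (u ⬝ᵥ v) ^ 2 ≤ (u ⬝ᵥ u) * (v ⬝ᵥ v) := by
  have := Finset.sum_mul_sq_le_sq_mul_sq Finset.univ u v
  simpa [dotProduct, pow_two] using this

theorem abs_dotProduct_le {N : ℕ} (u v : Fin N → ℝ) :
    |u ⬝ᵥ v| ≤ √((u ⬝ᵥ u) * (v ⬝ᵥ v)) := Real.abs_le_sqrt (sq_dotProduct_le u v)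

/-- Only the Gram matrix matters, so `u` and `v` may be replaced by planar vectors at angle `θ =
arccos ρ`, and the angular integral applies. -/
theorem integral_abs_mul_abs_gaussVec {N : ℕ} (u v : Fin N → ℝ) :
    ∫ w, |w ⬝ᵥ u| * |w ⬝ᵥ v| ∂(gaussVec N) =
      u ⬝ᵥ v + 2 / Real.pi * pairDrift (√((u ⬝ᵥ u) * (v ⬝ᵥ v))) (u ⬝ᵥ v) := by
  set q := √((u ⬝ᵥ u) * (v ⬝ᵥ v)) with hq
  have hu : 0 ≤ u ⬝ᵥ u := Finset.sum_nonneg fun i _ => mul_self_nonneg _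
  have hv : 0 ≤ v ⬝ᵥ v := Finset.sum_nonneg fun i _ => mul_self_nonneg _
  have hcq : |u ⬝ᵥ v| ≤ q := abs_dotProduct_le u v
  have hq0 : 0 ≤ q := Real.sqrt_nonneg _
  set ρ := (u ⬝ᵥ v) / q with hρ
  -- This covers `q = 0` as well, where Cauchy–Schwarz makes the inner product vanish.
  have hρq : q * ρ = u ⬝ᵥ v := by
    rcases eq_or_ne q 0 with h | h
    · rw [h, abs_nonpos_iff] at hcq
      · rw [hcq, h, zero_mul]
    · rw [hρ]; field_simp
  have hρ1 : |ρ| ≤ 1 := by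
    rw [hρ, abs_div, abs_of_nonneg hq0]
    exact div_le_one_of_le₀ hcq hq0
  have hqs : q = √(u ⬝ᵥ u) * √(v ⬝ᵥ v) := Real.sqrt_mul hu _
  set θ := Real.arccos ρ with hθ
  have hcos : Real.cos θ = ρ := Real.cos_arccos (abs_le.1 hρ1).1 (abs_le.1 hρ1).2
  have hsin : Real.sin θ = √(1 - ρ ^ 2) := Real.sin_arccos ρ
  have hmod := integral_pair_gaussVec_congr (u := u) (u' := v) (v := ![√(u ⬝ᵥ u), 0])
    (v' := ![√(v ⬝ᵥ v) * Real.cos θ, √(v ⬝ᵥ v) * Real.sin θ])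
    (f := fun p => |p.1| * |p.2|) (by simp [hu])
    (by
      simp only [dotProduct, Fin.sum_univ_two, Matrix.cons_val_zero, Matrix.cons_val_one]
      have := Real.mul_self_sqrt hv
      simp only [dotProduct] at this
      linear_combination (-Real.cos θ ^ 2 - Real.sin θ ^ 2) * this -
        (∑ i, v i * v i) * Real.sin_sq_add_cos_sq θ)
    (by
      rw [← hρq, hqs, ← hcos]
      simp only [dotProduct, Fin.sum_univ_two, Matrix.cons_val_zero, Matrix.cons_val_one]
      ring)
    (by fun_prop)
  simp only at hmod
  rw [hmod]
  have hpres := (measurePreserving_finTwoArrow (gaussianReal 0 1))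
  have hmod2 := hpres.integral_comp (MeasurableEquiv.finTwoArrow.measurableEmbedding)
    (fun p : ℝ × ℝ => q * (|p.1| * |Real.cos θ * p.1 + Real.sin θ * p.2|))
  have e : ∀ w : Fin 2 → ℝ, |w ⬝ᵥ ![√(u ⬝ᵥ u), 0]| *
      |w ⬝ᵥ ![√(v ⬝ᵥ v) * Real.cos θ, √(v ⬝ᵥ v) * Real.sin θ]| =
      q * (|w 0| * |Real.cos θ * w 0 + Real.sin θ * w 1|) := fun w => by
    have e1 : w ⬝ᵥ ![√(u ⬝ᵥ u), 0] = √(u ⬝ᵥ u) * w 0 := by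
      simp [dotProduct, Fin.sum_univ_two, mul_comm]
    have e2 : w ⬝ᵥ ![√(v ⬝ᵥ v) * Real.cos θ, √(v ⬝ᵥ v) * Real.sin θ] =
        √(v ⬝ᵥ v) * (Real.cos θ * w 0 + Real.sin θ * w 1) := by
      simp only [dotProduct, Fin.sum_univ_two, Matrix.cons_val_zero, Matrix.cons_val_one]
      ring
    rw [e1, e2, abs_mul, abs_mul, abs_of_nonneg (Real.sqrt_nonneg _),
      abs_of_nonneg (Real.sqrt_nonneg _), hqs]
    ring
  simp_rw [e]
  refine hmod2.trans ?_
  rw [integral_const_mul, integral_homogeneous_gaussian_prod_eq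
    (fun p => |p.1| * |Real.cos θ * p.1 + Real.sin θ * p.2|) (fun r ψ hr => by
      have : Real.cos θ * (r * Real.cos ψ) + Real.sin θ * (r * Real.sin ψ) =
        r * (Real.cos θ * Real.cos ψ + Real.sin θ * Real.sin ψ) := by ring
      simp only [this, abs_mul, abs_of_pos hr]
      ring),
    integral_abs_cos_mul_abs_cos_sub (Real.arccos_nonneg _) (Real.arccos_le_pi _), hcos, hsin,
    pairDrift, ← hρ, arcKerExt_of_mem hρ1, arcKer, ← hρq, ← hθ]
  have := Real.pi_pos.ne'
  field_simp
  ring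

/-! ### Activations of the form `A x + B |x|` -/

/-- The piecewise linear function `x ↦ A x + B |x|`. -/
noncomputable def absLin (A B x : ℝ) : ℝ := A * x + B * |x|

theorem continuous_absLin (A B : ℝ) : Continuous (absLin A B) := by
  unfold absLin
  fun_prop

theorem abs_absLin_le (A B x : ℝ) : |absLin A B x| ≤ (|A| + |B|) * |x| := by
  refine (abs_add_le _ _).trans_eq ?_
  rw [abs_mul, abs_mul, abs_abs, add_mul]

/-- The even part of the slopes of the shaped ReLU. -/
noncomputable def reluLin (cp cm p : ℝ) (n : ℕ) : ℝ := 1 + (cp + cm) / 2 / (n : ℝ) ^ p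

/-- The odd part of the slopes of the shaped ReLU. -/
noncomputable def reluAbs (cp cm p : ℝ) (n : ℕ) : ℝ := (cp - cm) / 2 / (n : ℝ) ^ p

theorem shapedReLU_eq (cp cm p : ℝ) (n : ℕ) :
    shapedReLU cp cm p n = absLin (reluLin cp cm p n) (reluAbs cp cm p n) := by
  ext x
  rw [shapedReLU, absLin, reluLin, reluAbs]
  rcases le_total 0 x with h | h
  · rw [max_eq_left h, min_eq_right h, abs_of_nonneg h]; ring
  · rw [max_eq_right h, min_eq_left h, abs_of_nonpos h]; ring

/-- The integrand is odd, while `(u, v)` and `(-u, -v)` have the same Gram matrix. -/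
theorem integral_dotProduct_mul_abs_gaussVec {N : ℕ} (u v : Fin N → ℝ) :
    ∫ w, (w ⬝ᵥ u) * |w ⬝ᵥ v| ∂(gaussVec N) = 0 := by
  have h := integral_pair_gaussVec_congr (u := u) (u' := v) (v := -u) (v' := -v)
    (f := fun p => p.1 * |p.2|) (by simp) (by simp) (by simp) (by fun_prop)
  simp only [dotProduct_neg, abs_neg, neg_mul, integral_neg] at h
  linarith

theorem memLp_abs_dotProduct_gaussVec {N : ℕ} (u : Fin N → ℝ) {p : ENNReal} (hp : p ≠ ⊤) :
    MemLp (fun w => |w ⬝ᵥ u|) p (gaussVec N) :=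
  (memLp_dotProduct_gaussVec u hp).abs

/-- The mixed terms of the expansion vanish by symmetry, so the nonlinear correction carries the
factor `B²`; this fixes the time scale `n^(2p)`. -/
theorem integral_absLin_mul_absLin {N : ℕ} (A B : ℝ) (u v : Fin N → ℝ) :
    ∫ w, absLin A B (w ⬝ᵥ u) * absLin A B (w ⬝ᵥ v) ∂(gaussVec N) =
      (A ^ 2 + B ^ 2) * (u ⬝ᵥ v) +
        B ^ 2 * (2 / Real.pi * pairDrift (√((u ⬝ᵥ u) * (v ⬝ᵥ v))) (u ⬝ᵥ v)) := by
  have e : ∀ w : Fin N → ℝ, absLin A B (w ⬝ᵥ u) * absLin A B (w ⬝ᵥ v) =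
      A ^ 2 * ((w ⬝ᵥ u) * (w ⬝ᵥ v)) + A * B * ((w ⬝ᵥ u) * |w ⬝ᵥ v|) +
        A * B * ((w ⬝ᵥ v) * |w ⬝ᵥ u|) + B ^ 2 * (|w ⬝ᵥ u| * |w ⬝ᵥ v|) := fun w => by
    simp only [absLin]; ring
  have i1 : Integrable (fun w => (w ⬝ᵥ u) * (w ⬝ᵥ v)) (gaussVec N) :=
    integrable_dotProduct_mul_gaussVec u v
  have i2 : ∀ x y : Fin N → ℝ, Integrable (fun w => (w ⬝ᵥ x) * |w ⬝ᵥ y|) (gaussVec N) :=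
    fun x y => (memLp_dotProduct_gaussVec x (p := 2) ENNReal.ofNat_ne_top).integrable_mul
      (memLp_abs_dotProduct_gaussVec y (p := 2) ENNReal.ofNat_ne_top)
  have i3 : Integrable (fun w => |w ⬝ᵥ u| * |w ⬝ᵥ v|) (gaussVec N) :=
    (memLp_abs_dotProduct_gaussVec u (p := 2) ENNReal.ofNat_ne_top).integrable_mul
      (memLp_abs_dotProduct_gaussVec v (p := 2) ENNReal.ofNat_ne_top)
  simp_rw [e]
  rw [integral_add ((((i1.const_mul _).fun_add ((i2 u v).const_mul _))).fun_add
      ((i2 v u).const_mul _)) (i3.const_mul _),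
    integral_add ((i1.const_mul _).fun_add ((i2 u v).const_mul _)) ((i2 v u).const_mul _),
    integral_add (i1.const_mul _) ((i2 u v).const_mul _)]
  simp only [integral_const_mul]
  rw [integral_dotProduct_mul_gaussVec, integral_dotProduct_mul_abs_gaussVec,
    integral_dotProduct_mul_abs_gaussVec, integral_abs_mul_abs_gaussVec]
  ring

/-- The case `u = v` of the mean formula for a unit vector, where the correction vanishes. Thus the
He constant removes exactly the factor `A² + B²`. -/
theorem heConst_absLin (A B : ℝ) : heConst (absLin A B) = (A ^ 2 + B ^ 2)⁻¹ := by
  have hmap := map_dotProduct_gaussVec ![(1 : ℝ)]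
  have e := integral_map (φ := fun w => w ⬝ᵥ ![(1 : ℝ)]) (μ := gaussVec 1)
    (f := fun x => absLin A B x ^ 2) (measurable_dotProduct_right _).aemeasurable
    (((continuous_absLin A B).pow 2).measurable.aestronglyMeasurable)
  have hone : (![(1 : ℝ)] ⬝ᵥ ![(1 : ℝ)]) = 1 := by simp
  rw [hmap, hone, Real.sqrt_one] at e
  simp only [one_mul, Measure.map_id'] at e
  have h := integral_absLin_mul_absLin A B ![(1 : ℝ)] ![(1 : ℝ)]
  rw [hone] at h
  rw [heConst, e]
  simp_rw [pow_two (absLin A B _)]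
  rw [h]
  simp [pairDrift_self]

/-- The fourth moment of the standard Gaussian. -/
noncomputable def gaussFourth : ℝ := ∫ x, x ^ 4 ∂(gaussianReal 0 1)

theorem gaussFourth_nonneg : 0 ≤ gaussFourth := integral_nonneg fun x => by positivity

theorem integral_dotProduct_pow_four_gaussVec {N : ℕ} (u : Fin N → ℝ) :
    ∫ w, (w ⬝ᵥ u) ^ 4 ∂(gaussVec N) = (u ⬝ᵥ u) ^ 2 * gaussFourth := by
  rw [integral_dotProduct_pow_gaussVec, gaussFourth,
    show √(u ⬝ᵥ u) ^ 4 = (√(u ⬝ᵥ u) ^ 2) ^ 2 by ring,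
    Real.sq_sqrt (show 0 ≤ u ⬝ᵥ u from Finset.sum_nonneg fun i _ => mul_self_nonneg _)]

theorem integrable_dotProduct_pow_four_gaussVec {N : ℕ} (u : Fin N → ℝ) :
    Integrable (fun w => (w ⬝ᵥ u) ^ 4) (gaussVec N) := by
  have := (memLp_dotProduct_gaussVec u (p := 4) ENNReal.ofNat_ne_top).integrable_norm_pow
    (by norm_num)
  refine this.congr (ae_of_all _ fun w => ?_)
  simp [Real.norm_eq_abs, (show Even 4 by decide).pow_abs]

theorem sq_absLin_mul_absLin_le (A B x y : ℝ) :
    (absLin A B x * absLin A B y) ^ 2 ≤ (|A| + |B|) ^ 4 * ((x ^ 4 + y ^ 4) / 2) := by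
  have hx := abs_absLin_le A B x
  have hy := abs_absLin_le A B y
  have h1 : |absLin A B x * absLin A B y| ≤ (|A| + |B|) ^ 2 * (|x| * |y|) := by
    rw [abs_mul]
    calc _ ≤ ((|A| + |B|) * |x|) * ((|A| + |B|) * |y|) :=
          mul_le_mul hx hy (abs_nonneg _) (by positivity)
      _ = _ := by ring
  have h2 := pow_le_pow_left₀ (abs_nonneg _) h1 2
  rw [sq_abs] at h2
  refine h2.trans ?_
  rw [mul_pow, ← pow_mul, mul_pow, sq_abs, sq_abs]
  refine mul_le_mul_of_nonneg_left ?_ (by positivity)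
  nlinarith [sq_nonneg (x ^ 2 - y ^ 2)]

theorem aestronglyMeasurable_absLin_mul {N : ℕ} (A B : ℝ) (u v : Fin N → ℝ) :
    AEStronglyMeasurable (fun w => absLin A B (w ⬝ᵥ u) * absLin A B (w ⬝ᵥ v)) (gaussVec N) :=
  (((continuous_absLin A B).measurable.comp (measurable_dotProduct_right u)).mul
    ((continuous_absLin A B).measurable.comp (measurable_dotProduct_right v))).aestronglyMeasurable

theorem integrable_sq_absLin_mul {N : ℕ} (A B : ℝ) (u v : Fin N → ℝ) :
    Integrable (fun w => (absLin A B (w ⬝ᵥ u) * absLin A B (w ⬝ᵥ v)) ^ 2) (gaussVec N) := by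
  refine Integrable.mono' ((((integrable_dotProduct_pow_four_gaussVec u).add
    (integrable_dotProduct_pow_four_gaussVec v)).div_const 2).const_mul ((|A| + |B|) ^ 4))
    ((aestronglyMeasurable_absLin_mul A B u v).pow 2) (ae_of_all _ fun w => ?_)
  rw [Real.norm_of_nonneg (sq_nonneg _)]
  exact sq_absLin_mul_absLin_le _ _ _ _

theorem memLp_absLin_mul {N : ℕ} (A B : ℝ) (u v : Fin N → ℝ) :
    MemLp (fun w => absLin A B (w ⬝ᵥ u) * absLin A B (w ⬝ᵥ v)) 2 (gaussVec N) :=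
  (memLp_two_iff_integrable_sq (aestronglyMeasurable_absLin_mul A B u v)).2
    (integrable_sq_absLin_mul A B u v)

theorem integral_sq_absLin_mul_le {N : ℕ} (A B : ℝ) (u v : Fin N → ℝ) :
    ∫ w, (absLin A B (w ⬝ᵥ u) * absLin A B (w ⬝ᵥ v)) ^ 2 ∂(gaussVec N) ≤
      (|A| + |B|) ^ 4 * gaussFourth * (((u ⬝ᵥ u) ^ 2 + (v ⬝ᵥ v) ^ 2) / 2) := by
  have iu := integrable_dotProduct_pow_four_gaussVec u
  have iv := integrable_dotProduct_pow_four_gaussVec v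
  refine (integral_mono (integrable_sq_absLin_mul A B u v)
    (((iu.add iv).div_const 2).const_mul ((|A| + |B|) ^ 4))
    fun w => sq_absLin_mul_absLin_le _ _ _ _).trans_eq ?_
  simp only [Pi.add_apply]
  rw [integral_const_mul, integral_div, integral_add iu iv, integral_dotProduct_pow_four_gaussVec,
    integral_dotProduct_pow_four_gaussVec]
  ring

/-! ### One random layer -/

/-- The law of an `n × N` matrix with iid standard Gaussian entries. -/
noncomputable abbrev gaussMat (n N : ℕ) : Measure (Fin n → Fin N → ℝ) :=
  Measure.pi fun _ => gaussVec N

/-- Bias–variance decomposition: rows are independent, so variances add, and each is at most the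
second moment. -/
theorem lintegral_sq_sum_sub_le {n N : ℕ} {f : (Fin N → ℝ) → ℝ} (hf : MemLp f 2 (gaussVec N))
    (r y : ℝ) :
    ∫⁻ M, ENNReal.ofReal ((r * ∑ i, f (M i) - y) ^ 2) ∂(gaussMat n N) ≤
      ENNReal.ofReal (r ^ 2 * n * (∫ w, f w ^ 2 ∂(gaussVec N)) +
        (r * n * (∫ w, f w ∂(gaussVec N)) - y) ^ 2) := by
  set S : (Fin n → Fin N → ℝ) → ℝ := ∑ i, fun M => f (M i) with hS
  have hfi : ∀ i : Fin n, MemLp (fun M : Fin n → Fin N → ℝ => f (M i)) 2 (gaussMat n N) :=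
    fun i => hf.comp_measurePreserving (measurePreserving_eval _ i)
  have hSm : MemLp S 2 (gaussMat n N) := memLp_finsetSum' _ fun i _ => hfi i
  have hE : ∫ M, S M ∂(gaussMat n N) = n * ∫ w, f w ∂(gaussVec N) := by
    simp only [hS, Finset.sum_apply]
    rw [integral_finsetSum _ fun i _ => (hfi i).integrable one_le_two]
    have : ∀ i : Fin n, ∫ M : Fin n → Fin N → ℝ, f (M i) ∂(gaussMat n N) =
        ∫ w, f w ∂(gaussVec N) := fun i => by
      have hp := measurePreserving_eval (fun _ : Fin n => gaussVec N) i
      conv_rhs => rw [← hp.map_eq]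
      rw [integral_map hp.aemeasurable (by rw [hp.map_eq]; exact hf.1)]
    simp [this]
  have hV : variance S (gaussMat n N) ≤ n * ∫ w, f w ^ 2 ∂(gaussVec N) := by
    rw [hS, variance_sum_pi (X := fun _ : Fin n => f) (fun _ => hf)]
    simp only [Finset.sum_const, Finset.card_univ, Fintype.card_fin, nsmul_eq_mul]
    exact mul_le_mul_of_nonneg_left (variance_le_expectation_sq hf.1) (Nat.cast_nonneg _)
  have hT : MemLp (fun M => r * S M - y) 2 (gaussMat n N) :=
    (hSm.const_mul r).sub (memLp_const y)
  have hI : ∫ M, (r * S M - y) ^ 2 ∂(gaussMat n N) =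
      r ^ 2 * variance S (gaussMat n N) + (r * n * (∫ w, f w ∂(gaussVec N)) - y) ^ 2 := by
    have h1 := variance_eq_sub hSm
    have i1 : Integrable (fun M => S M ^ 2) (gaussMat n N) := hSm.integrable_sq
    have i2 : Integrable S (gaussMat n N) := hSm.integrable one_le_two
    simp only [Pi.pow_apply] at h1
    have e : ∀ M, (r * S M - y) ^ 2 = r ^ 2 * S M ^ 2 + (-2 * r * y) * S M + y ^ 2 :=
      fun M => by ring
    simp_rw [e]
    rw [integral_add ((i1.const_mul _).fun_add (i2.const_mul _)) (integrable_const _),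
      integral_add (i1.const_mul _) (i2.const_mul _), integral_const_mul, integral_const_mul,
      integral_const]
    simp only [probReal_univ, one_smul]
    rw [hE] at h1 ⊢
    linear_combination (-r ^ 2) * h1
  have hs : ∀ M : Fin n → Fin N → ℝ, ∑ i, f (M i) = S M := fun M => by simp [hS]
  simp_rw [hs]
  rw [← ofReal_integral_eq_lintegral_ofReal hT.integrable_sq (ae_of_all _ fun M => sq_nonneg _), hI]
  refine ENNReal.ofReal_le_ofReal (add_le_add_left ?_ _)
  rw [mul_assoc]
  exact mul_le_mul_of_nonneg_left hV (sq_nonneg r)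

/-- The mean square deviation of the covariance after one layer from a target value. -/
theorem lintegral_layer_le {n N : ℕ} (hn : n ≠ 0) {A B : ℝ} (hD : A ^ 2 + B ^ 2 ≠ 0)
    (u v : Fin N → ℝ) (y : ℝ) :
    ∫⁻ M : Fin n → Fin N → ℝ, ENNReal.ofReal (((A ^ 2 + B ^ 2)⁻¹ / n *
        ∑ i, absLin A B (M i ⬝ᵥ u) * absLin A B (M i ⬝ᵥ v) - y) ^ 2) ∂(gaussMat n N) ≤
      ENNReal.ofReal (((A ^ 2 + B ^ 2)⁻¹) ^ 2 * (|A| + |B|) ^ 4 * gaussFourth *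
          (((u ⬝ᵥ u) ^ 2 + (v ⬝ᵥ v) ^ 2) / 2) / n +
        (u ⬝ᵥ v + B ^ 2 / (A ^ 2 + B ^ 2) * (2 / Real.pi) *
          pairDrift (√((u ⬝ᵥ u) * (v ⬝ᵥ v))) (u ⬝ᵥ v) - y) ^ 2) := by
  have hn' : (n : ℝ) ≠ 0 := Nat.cast_ne_zero.2 hn
  refine (lintegral_sq_sum_sub_le (memLp_absLin_mul A B u v) _ y).trans
    (ENNReal.ofReal_le_ofReal (add_le_add ?_ (le_of_eq ?_)))
  · have h := integral_sq_absLin_mul_le A B u v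
    have e : ((A ^ 2 + B ^ 2)⁻¹ / n) ^ 2 * n = ((A ^ 2 + B ^ 2)⁻¹) ^ 2 / n := by field_simp
    rw [e]
    refine (mul_le_mul_of_nonneg_left h (by positivity)).trans_eq ?_
    ring
  · rw [integral_absLin_mul_absLin]
    congr 2
    field_simp

/-! ### The error after one layer -/

/-- The squared distance of the covariance `(a, b, c)` of a pair from the target `(a₀, b₀, y)`. -/
def pairErr (a₀ b₀ y a b c : ℝ) : ℝ := (a - a₀) ^ 2 + (b - b₀) ^ 2 + (c - y) ^ 2

theorem pairErr_nonneg (a₀ b₀ y a b c : ℝ) : 0 ≤ pairErr a₀ b₀ y a b c := by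
  unfold pairErr
  positivity

/-- The covariance of two features after a layer with weights `M`. -/
def nextCov {n N : ℕ} (φ : ℝ → ℝ) (r : ℝ) (M : Fin n → Fin N → ℝ) (u v : Fin N → ℝ) : ℝ :=
  r * ∑ i, φ (M i ⬝ᵥ u) * φ (M i ⬝ᵥ v)

/-- The squared distance of the pair covariance after a layer with weights `M` from a target. -/
def nextErr {n N : ℕ} (φ : ℝ → ℝ) (r a₀ b₀ y : ℝ) (M : Fin n → Fin N → ℝ) (u v : Fin N → ℝ) : ℝ :=
  pairErr a₀ b₀ y (nextCov φ r M u u) (nextCov φ r M v v) (nextCov φ r M u v)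

/-- Divide the difference of the squares by the sum of the roots, which is at least `√(a₀ b₀) > 0`.
The `+ 1` comes from `b ≤ b₀ + r` and `r ≤ 1`. -/
theorem abs_sqrt_mul_sub_sqrt_mul_le {a₀ b₀ a b r : ℝ} (ha₀ : 0 < a₀) (hb₀ : 0 < b₀)
    (ha : 0 ≤ a) (hb : 0 ≤ b) (hra : |a - a₀| ≤ r) (hrb : |b - b₀| ≤ r) (hr1 : r ≤ 1) :
    |√(a * b) - √(a₀ * b₀)| ≤ (a₀ + b₀ + 1) / √(a₀ * b₀) * r := by
  have hq₀ : 0 < √(a₀ * b₀) := Real.sqrt_pos.2 (mul_pos ha₀ hb₀)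
  have hr0 : 0 ≤ r := (abs_nonneg _).trans hra
  have h1 : |√(a * b) - √(a₀ * b₀)| * (√(a * b) + √(a₀ * b₀)) = |a * b - a₀ * b₀| := by
    rw [← abs_of_nonneg (show 0 ≤ √(a * b) + √(a₀ * b₀) by positivity), ← abs_mul]
    congr 1
    have e1 := Real.mul_self_sqrt (mul_nonneg ha hb)
    have e2 := Real.mul_self_sqrt (mul_nonneg ha₀.le hb₀.le)
    linear_combination e1 - e2
  have h2 : |a * b - a₀ * b₀| ≤ r * (a₀ + b₀ + 1) := by
    have e : a * b - a₀ * b₀ = (a - a₀) * b + a₀ * (b - b₀) := by ring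
    rw [e]
    refine (abs_add_le _ _).trans ?_
    rw [abs_mul, abs_mul, abs_of_nonneg hb, abs_of_pos ha₀]
    have hb1 : b ≤ b₀ + 1 := by linarith [(abs_le.1 hrb).2]
    have := mul_le_mul hra hb1 hb hr0
    have := mul_le_mul_of_nonneg_left hrb ha₀.le
    linarith
  rw [div_mul_eq_mul_div, le_div_iff₀ hq₀]
  have h3 : |√(a * b) - √(a₀ * b₀)| * √(a₀ * b₀) ≤ |a * b - a₀ * b₀| := by
    rw [← h1]
    exact mul_le_mul_of_nonneg_left (by linarith [Real.sqrt_nonneg (a * b)]) (abs_nonneg _)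
  linarith

/-- A Lipschitz constant of the drift of a pair near the initial covariance. -/
noncomputable def driftLip (C a₀ b₀ : ℝ) : ℝ :=
  C * (3 * Real.pi * ((a₀ + b₀ + 1) / √(a₀ * b₀)) + Real.pi)

theorem driftLip_nonneg {C a₀ b₀ : ℝ} (hC : 0 ≤ C) (ha₀ : 0 < a₀) (hb₀ : 0 < b₀) :
    0 ≤ driftLip C a₀ b₀ := by
  unfold driftLip
  have := Real.pi_pos
  positivity

/-- Comparison of the mean of one layer with one step of the flow: `η` measures the error of the
drift coefficient, `κ` the Euler error, and the rest is Lipschitz continuity of the drift. -/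
theorem sq_mean_step_le {C a₀ b₀ : ℝ} (hC : 0 ≤ C) (ha₀ : 0 < a₀) (hb₀ : 0 < b₀)
    {a b c y y' τ s η κ : ℝ} (ha : 0 ≤ a) (hb : 0 ≤ b) (hc : |c| ≤ √(a * b))
    (hE : pairErr a₀ b₀ y a b c ≤ 1) (hs : 1 ≤ s) (hη : |τ - C / s| ≤ η / s)
    (hy : |y' - y - 1 / s * (C * pairDrift √(a₀ * b₀) y)| ≤ κ / s) :
    (c + τ * pairDrift √(a * b) c - y') ^ 2 ≤ (c - y) ^ 2 +
      ((2 * driftLip C a₀ b₀ + 1 + 2 * driftLip C a₀ b₀ ^ 2) * pairErr a₀ b₀ y a b c +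
        3 * (2 * Real.pi * (a₀ + b₀ + 1) * η + κ) ^ 2) / s := by
  have hpi := Real.pi_pos
  have hs0 : 0 < s := by linarith
  set E := pairErr a₀ b₀ y a b c with hEdef
  set L := driftLip C a₀ b₀ with hL
  have hL0 : 0 ≤ L := driftLip_nonneg hC ha₀ hb₀
  set δ := 2 * Real.pi * (a₀ + b₀ + 1) * η + κ with hδ
  have hE0 : 0 ≤ E := pairErr_nonneg _ _ _ _ _ _
  set r := √E with hr
  have hr0 : 0 ≤ r := Real.sqrt_nonneg _
  have hr2 : r ^ 2 = E := Real.sq_sqrt hE0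
  have hr1 : r ≤ 1 := Real.sqrt_le_one.2 hE
  have hra : |a - a₀| ≤ r := Real.abs_le_sqrt (by
    rw [hEdef, pairErr]; linarith [sq_nonneg (b - b₀), sq_nonneg (c - y)])
  have hrb : |b - b₀| ≤ r := Real.abs_le_sqrt (by
    rw [hEdef, pairErr]; linarith [sq_nonneg (a - a₀), sq_nonneg (c - y)])
  have hrc : |c - y| ≤ r := Real.abs_le_sqrt (by
    rw [hEdef, pairErr]; linarith [sq_nonneg (a - a₀), sq_nonneg (b - b₀)])
  have hη0 : 0 ≤ η := by
    have h := (abs_nonneg _).trans hη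
    rwa [le_div_iff₀ hs0, zero_mul] at h
  have hκ0 : 0 ≤ κ := by
    have h := (abs_nonneg _).trans hy
    rwa [le_div_iff₀ hs0, zero_mul] at h
  have hδ0 : 0 ≤ δ := by positivity
  set q := √(a * b) with hq
  set q₀ := √(a₀ * b₀) with hq₀
  have hqq := abs_sqrt_mul_sub_sqrt_mul_le ha₀ hb₀ ha hb hra hrb hr1
  rw [← hq, ← hq₀] at hqq
  have hqR : q ≤ a₀ + b₀ + 1 := by
    rw [hq]
    refine Real.sqrt_le_iff.2 ⟨by linarith, ?_⟩
    have h1 : a ≤ a₀ + b₀ + 1 := by linarith [(abs_le.1 hra).2]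
    have h2 : b ≤ a₀ + b₀ + 1 := by linarith [(abs_le.1 hrb).2]
    rw [pow_two]
    exact mul_le_mul h1 h2 hb (by linarith)
  have hlip : C * |pairDrift q c - pairDrift q₀ y| ≤ L * r := by
    have h := abs_pairDrift_sub_pairDrift_le y (Real.sqrt_nonneg (a * b))
      (Real.sqrt_pos.2 (mul_pos ha₀ hb₀)) hc
    rw [hL, driftLip, mul_assoc]
    refine mul_le_mul_of_nonneg_left (h.trans ?_) hC
    have h1 := mul_le_mul_of_nonneg_left hqq (show 0 ≤ 3 * Real.pi by positivity)
    have h2 := mul_le_mul_of_nonneg_left hrc hpi.le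
    linarith
  have hbd : |pairDrift q c| ≤ 2 * Real.pi * (a₀ + b₀ + 1) :=
    (abs_pairDrift_le (Real.sqrt_nonneg _) c).trans
      (mul_le_mul_of_nonneg_left hqR (by positivity))
  set Δ := τ * pairDrift q c - (y' - y) with hΔ
  -- Coefficient error, Lipschitz error and Euler error, in this order.
  have hΔe : Δ = (τ - C / s) * pairDrift q c + 1 / s * (C * (pairDrift q c - pairDrift q₀ y)) -
      (y' - y - 1 / s * (C * pairDrift q₀ y)) := by
    rw [hΔ]; ring
  have hΔb : |Δ| ≤ (L * r + δ) / s := by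
    rw [hΔe]
    refine (abs_sub _ _).trans ((add_le_add (abs_add_le _ _) hy).trans ?_)
    rw [abs_mul, abs_mul, abs_mul, abs_of_nonneg hC, abs_of_pos (by positivity : (0 : ℝ) < 1 / s)]
    have h1 := mul_le_mul hη hbd (abs_nonneg _) (by positivity)
    have h2 := mul_le_mul_of_nonneg_left hlip (by positivity : (0 : ℝ) ≤ 1 / s)
    calc _ ≤ η / s * (2 * Real.pi * (a₀ + b₀ + 1)) + 1 / s * (L * r) + κ / s := by linarith
      _ = _ := by rw [hδ]; ring
  have hX : 0 ≤ L * r + δ := by positivity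
  have hsq : Δ ^ 2 ≤ (L * r + δ) ^ 2 / s := by
    have h := pow_le_pow_left₀ (abs_nonneg _) hΔb 2
    rw [sq_abs, div_pow] at h
    refine h.trans (div_le_div_of_nonneg_left (sq_nonneg _) hs0 ?_)
    -- Since `1 ≤ s`, the denominator `s²` may be weakened to `s`.
    nlinarith
  have hcr : 2 * ((c - y) * Δ) ≤ 2 * (r * (L * r + δ)) / s := by
    have h := mul_le_mul hrc hΔb (abs_nonneg _) hr0
    rw [← abs_mul] at h
    have := (le_abs_self _).trans h
    calc _ ≤ 2 * (r * ((L * r + δ) / s)) := by linarith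
      _ = _ := by ring
  have e : (c + τ * pairDrift q c - y') ^ 2 = (c - y) ^ 2 + 2 * ((c - y) * Δ) + Δ ^ 2 := by
    rw [hΔ]; ring
  rw [e]
  have hfin : 2 * (r * (L * r + δ)) / s + (L * r + δ) ^ 2 / s ≤
      ((2 * L + 1 + 2 * L ^ 2) * E + 3 * δ ^ 2) / s := by
    rw [← add_div]
    refine div_le_div_of_nonneg_right ?_ hs0.le
    rw [← hr2, ← sub_nonneg]
    -- The constants of the statement are those for which Young's inequality leaves this sum of two
    -- squares.
    have e' : (2 * L + 1 + 2 * L ^ 2) * r ^ 2 + 3 * δ ^ 2 -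
        (2 * (r * (L * r + δ)) + (L * r + δ) ^ 2) = (r - δ) ^ 2 + (L * r - δ) ^ 2 := by ring
    rw [e']
    positivity
  linarith

theorem measurable_nextErr {n N : ℕ} {φ : ℝ → ℝ} (hφ : Continuous φ) (r a₀ b₀ y : ℝ) :
    Measurable fun z : (Fin n → Fin N → ℝ) × (Fin N → ℝ) × (Fin N → ℝ) =>
      nextErr φ r a₀ b₀ y z.1 z.2.1 z.2.2 := by
  have : Continuous fun z : (Fin n → Fin N → ℝ) × (Fin N → ℝ) × (Fin N → ℝ) =>
      nextErr φ r a₀ b₀ y z.1 z.2.1 z.2.2 := by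
    unfold nextErr pairErr nextCov dotProduct
    fun_prop
  exact this.measurable

theorem measurable_nextCov {n N : ℕ} {φ : ℝ → ℝ} (hφ : Continuous φ) (r : ℝ) (u v : Fin N → ℝ) :
    Measurable fun M : Fin n → Fin N → ℝ => nextCov φ r M u v := by
  have : Continuous fun M : Fin n → Fin N → ℝ => nextCov φ r M u v := by
    unfold nextCov dotProduct
    fun_prop
  exact this.measurable

theorem dotProduct_self_nonneg_real {N : ℕ} (u : Fin N → ℝ) : 0 ≤ u ⬝ᵥ u :=
  Finset.sum_nonneg fun _ _ => mul_self_nonneg _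

/-- The expected error after one layer. -/
theorem lintegral_nextErr_le {n N : ℕ} (hn : n ≠ 0) {A B : ℝ} (hD : A ^ 2 + B ^ 2 ≠ 0)
    {C a₀ b₀ : ℝ} (hC : 0 ≤ C) (ha₀ : 0 < a₀) (hb₀ : 0 < b₀) {y y' s η κ ζ : ℝ}
    (u v : Fin N → ℝ) (hE : pairErr a₀ b₀ y (u ⬝ᵥ u) (v ⬝ᵥ v) (u ⬝ᵥ v) ≤ 1) (hs : 1 ≤ s)
    (hη : |B ^ 2 / (A ^ 2 + B ^ 2) * (2 / Real.pi) - C / s| ≤ η / s)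
    (hy : |y' - y - 1 / s * (C * pairDrift √(a₀ * b₀) y)| ≤ κ / s)
    (hζ : ((A ^ 2 + B ^ 2)⁻¹) ^ 2 * (|A| + |B|) ^ 4 * gaussFourth * (a₀ + b₀ + 1) ^ 2 / n ≤
      ζ / s) :
    ∫⁻ M : Fin n → Fin N → ℝ, ENNReal.ofReal (nextErr (absLin A B) ((A ^ 2 + B ^ 2)⁻¹ / n)
        a₀ b₀ y' M u v) ∂(gaussMat n N) ≤
      ENNReal.ofReal ((1 + (2 * driftLip C a₀ b₀ + 1 + 2 * driftLip C a₀ b₀ ^ 2) / s) *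
        pairErr a₀ b₀ y (u ⬝ᵥ u) (v ⬝ᵥ v) (u ⬝ᵥ v) +
        (3 * (2 * Real.pi * (a₀ + b₀ + 1) * η + κ) ^ 2 + 3 * ζ) / s) := by
  have hu := dotProduct_self_nonneg_real u
  have hv := dotProduct_self_nonneg_real v
  set Q := ((A ^ 2 + B ^ 2)⁻¹) ^ 2 * (|A| + |B|) ^ 4 * gaussFourth with hQ
  have hQ0 : 0 ≤ Q := by have := gaussFourth_nonneg; positivity
  have hcs := abs_dotProduct_le u v
  have hua : u ⬝ᵥ u ≤ a₀ + b₀ + 1 := by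
    have : (u ⬝ᵥ u - a₀) ^ 2 ≤ 1 := by
      unfold pairErr at hE; linarith [sq_nonneg (v ⬝ᵥ v - b₀), sq_nonneg (u ⬝ᵥ v - y)]
    linarith [(abs_le.1 ((sq_le_one_iff_abs_le_one _).1 this)).2]
  have hvb : v ⬝ᵥ v ≤ a₀ + b₀ + 1 := by
    have : (v ⬝ᵥ v - b₀) ^ 2 ≤ 1 := by
      unfold pairErr at hE; linarith [sq_nonneg (u ⬝ᵥ u - a₀), sq_nonneg (u ⬝ᵥ v - y)]
    linarith [(abs_le.1 ((sq_le_one_iff_abs_le_one _).1 this)).2]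
  have hvar : ∀ x x' : ℝ, 0 ≤ x → 0 ≤ x' → x ≤ a₀ + b₀ + 1 → x' ≤ a₀ + b₀ + 1 →
      Q * ((x ^ 2 + x' ^ 2) / 2) / n ≤ ζ / s := fun x x' h0 h0' h1 h1' => by
    refine le_trans (div_le_div_of_nonneg_right (mul_le_mul_of_nonneg_left ?_ hQ0)
      (Nat.cast_nonneg n)) hζ
    have := pow_le_pow_left₀ h0 h1 2
    have := pow_le_pow_left₀ h0' h1' 2
    linarith
  -- On the diagonal there is no drift, so the error grows only by the variance term.
  have hdiag : ∀ (x : Fin N → ℝ) (t : ℝ), x ⬝ᵥ x ≤ a₀ + b₀ + 1 →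
      ∫⁻ M : Fin n → Fin N → ℝ, ENNReal.ofReal ((nextCov (absLin A B) ((A ^ 2 + B ^ 2)⁻¹ / n)
        M x x - t) ^ 2) ∂(gaussMat n N) ≤ ENNReal.ofReal (ζ / s + (x ⬝ᵥ x - t) ^ 2) := by
    intro x t hx
    have hx0 := dotProduct_self_nonneg_real x
    refine (lintegral_layer_le hn hD x x t).trans (ENNReal.ofReal_le_ofReal ?_)
    rw [Real.sqrt_mul_self hx0, pairDrift_self, mul_zero, add_zero]
    exact add_le_add_left (hvar _ _ hx0 hx0 hx hx) _
  have hoff : ∫⁻ M : Fin n → Fin N → ℝ, ENNReal.ofReal ((nextCov (absLin A B)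
      ((A ^ 2 + B ^ 2)⁻¹ / n) M u v - y') ^ 2) ∂(gaussMat n N) ≤
      ENNReal.ofReal (ζ / s + ((u ⬝ᵥ v - y) ^ 2 +
      ((2 * driftLip C a₀ b₀ + 1 + 2 * driftLip C a₀ b₀ ^ 2) *
        pairErr a₀ b₀ y (u ⬝ᵥ u) (v ⬝ᵥ v) (u ⬝ᵥ v) +
        3 * (2 * Real.pi * (a₀ + b₀ + 1) * η + κ) ^ 2) / s)) := by
    refine (lintegral_layer_le hn hD u v y').trans (ENNReal.ofReal_le_ofReal ?_)
    exact add_le_add (hvar _ _ hu hv hua hvb)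
      (sq_mean_step_le hC ha₀ hb₀ hu hv hcs hE hs hη hy)
  have hm : ∀ (x x' : Fin N → ℝ) (t : ℝ), Measurable fun M : Fin n → Fin N → ℝ =>
      ENNReal.ofReal ((nextCov (absLin A B) ((A ^ 2 + B ^ 2)⁻¹ / n) M x x' - t) ^ 2) :=
    fun x x' t => (((measurable_nextCov (continuous_absLin A B) _ x x').sub_const t).pow_const
      2).ennreal_ofReal
  simp only [nextErr, pairErr]
  have hsplit : ∀ M : Fin n → Fin N → ℝ, ENNReal.ofReal
      ((nextCov (absLin A B) ((A ^ 2 + B ^ 2)⁻¹ / n) M u u - a₀) ^ 2 +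
      (nextCov (absLin A B) ((A ^ 2 + B ^ 2)⁻¹ / n) M v v - b₀) ^ 2 +
      (nextCov (absLin A B) ((A ^ 2 + B ^ 2)⁻¹ / n) M u v - y') ^ 2) =
      ENNReal.ofReal ((nextCov (absLin A B) ((A ^ 2 + B ^ 2)⁻¹ / n) M u u - a₀) ^ 2) +
      ENNReal.ofReal ((nextCov (absLin A B) ((A ^ 2 + B ^ 2)⁻¹ / n) M v v - b₀) ^ 2) +
      ENNReal.ofReal ((nextCov (absLin A B) ((A ^ 2 + B ^ 2)⁻¹ / n) M u v - y') ^ 2) :=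
    fun M => by
      rw [ENNReal.ofReal_add (by positivity) (sq_nonneg _),
        ENNReal.ofReal_add (sq_nonneg _) (sq_nonneg _)]
  simp_rw [hsplit]
  rw [lintegral_add_right _ (hm u v y'), lintegral_add_left (hm u u a₀)]
  refine (add_le_add (add_le_add (hdiag u a₀ hua) (hdiag v b₀ hvb)) hoff).trans ?_
  have hζ0 : 0 ≤ ζ / s := le_trans (by positivity) hζ
  have hL := driftLip_nonneg hC ha₀ hb₀
  have hE0 := pairErr_nonneg a₀ b₀ y (u ⬝ᵥ u) (v ⬝ᵥ v) (u ⬝ᵥ v)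
  have hs0 : 0 < s := by linarith
  rw [← ENNReal.ofReal_add (by positivity) (by positivity),
    ← ENNReal.ofReal_add (by positivity) (by positivity)]
  refine ENNReal.ofReal_le_ofReal (le_of_eq ?_)
  unfold pairErr
  ring

/-! ### Functions of disjoint sets of coordinates of a product measure -/

/-- The factor is obtained by setting the coordinates outside `S` to zero. -/
theorem DependsOn.exists_factor {ι β : Type*} [MeasurableSpace β] {f : (ι → ℝ) → β}
    (hf : Measurable f) {S : Finset ι} (h : DependsOn f (S : Set ι)) :
    ∃ g : (S → ℝ) → β, Measurable g ∧ ∀ w, f w = g fun i => w i := by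
  classical
  refine ⟨fun r => f fun i => if hi : i ∈ S then r ⟨i, hi⟩ else 0, hf.comp ?_, fun w => h ?_⟩
  · refine measurable_pi_lambda _ fun i => ?_
    by_cases hi : i ∈ S
    · simp only [hi, dif_pos]; fun_prop
    · simp only [hi, dif_neg, not_false_eq_true]; fun_prop
  · intro i hi
    simp [Finset.mem_coe.1 hi]

theorem DependsOn.indepFun_infinitePi {ι β γ : Type*} [MeasurableSpace β] [MeasurableSpace γ]
    {ν : ι → Measure ℝ} [∀ i, IsProbabilityMeasure (ν i)] {f : (ι → ℝ) → β} {g : (ι → ℝ) → γ}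
    (hf : Measurable f) (hg : Measurable g) {S T : Finset ι} (hfS : DependsOn f (S : Set ι))
    (hgT : DependsOn g (T : Set ι)) (hST : Disjoint S T) :
    IndepFun f g (Measure.infinitePi ν) := by
  obtain ⟨f', hf', hff⟩ := hfS.exists_factor hf
  obtain ⟨g', hg', hgg⟩ := hgT.exists_factor hg
  have hi : iIndepFun (fun i (w : ι → ℝ) => w i) (Measure.infinitePi ν) :=
    iIndepFun_infinitePi (X := fun _ x => x) fun _ => measurable_id
  have := (hi.indepFun_finset S T hST fun i => measurable_pi_apply i).comp hf' hg'
  convert this using 1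
  · exact funext hff
  · exact funext hgg

/-- Tonelli for an independent pair: the fresh layer is integrated out with the past frozen. This
replaces conditional expectations. -/
theorem lintegral_indepFun_eq {Ω β γ : Type*} [MeasurableSpace Ω] [MeasurableSpace β]
    [MeasurableSpace γ] {μ : Measure Ω} [IsProbabilityMeasure μ] {Z : Ω → β} {H : Ω → γ}
    (hZ : Measurable Z) (hH : Measurable H) (h : IndepFun Z H μ) {F : β × γ → ENNReal}
    (hF : Measurable F) :
    ∫⁻ ω, F (Z ω, H ω) ∂μ = ∫⁻ ω, ∫⁻ x, F (Z ω, x) ∂(μ.map H) ∂μ := by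
  have : IsProbabilityMeasure (μ.map H) := Measure.isProbabilityMeasure_map hH.aemeasurable
  rw [← lintegral_map hF (hZ.prodMk hH),
    (indepFun_iff_map_prod_eq_prod_map_map hZ.aemeasurable hH.aemeasurable).1 h,
    lintegral_prod _ hF.aemeasurable, lintegral_map hF.lintegral_prod_right' hZ]

/-! ### The layers of the network -/

/-- The joint law of iid standard Gaussian weights. -/
noncomputable def weightLaw (nin n : ℕ) : Measure (WeightIdx nin n → ℝ) :=
  Measure.infinitePi fun _ => gaussianReal 0 1

instance (nin n : ℕ) : IsProbabilityMeasure (weightLaw nin n) := by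
  unfold weightLaw
  infer_instance

/-- Transfers every probability to one canonical product measure, on which the coordinates are
honestly measurable. -/
theorem IsStdGaussianInit.map_eq {nin n : ℕ} {Ω : Type*} [MeasurableSpace Ω] {P : Measure Ω}
    {W : WeightIdx nin n → Ω → ℝ} (h : IsStdGaussianInit P W) :
    AEMeasurable (fun ω i => W i ω) P ∧ P.map (fun ω i => W i ω) = weightLaw nin n := by
  have hm : AEMeasurable (fun ω i => W i ω) P := aemeasurable_pi_iff.2 fun i => (h.2 i).aemeasurable
  exact ⟨hm, (h.1.hasLaw_infinitePi h.2 hm).map_eq⟩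

section Network

variable {nin n : ℕ}

/-- The rescaled input, whose Gram matrix is the input covariance. -/
noncomputable def inputFeature (x : EuclideanSpace ℝ (Fin nin)) : Fin nin → ℝ :=
  (1 / √(nin : ℝ)) • fun j => x j

/-- The rescaled activations, whose Gram matrix is the layer covariance. -/
noncomputable def feature (φ : ℝ → ℝ) (w : WeightIdx nin n → ℝ) (x : EuclideanSpace ℝ (Fin nin))
    (l : ℕ) : Fin n → ℝ :=
  √(heConst φ / n) • fun j => φ (preact φ w x l j)

/-- The input weights as a family of rows. -/
def inputRows (w : WeightIdx nin n → ℝ) : Fin n → Fin nin → ℝ := fun i j => w (Sum.inl (i, j))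

/-- The weights of a hidden layer as a family of rows. -/
def hiddenRows (l : ℕ) (w : WeightIdx nin n → ℝ) : Fin n → Fin n → ℝ :=
  fun i j => w (Sum.inr (l, i, j))

/-- The normalization is moved from the output to the feature, so that covariances become Gram
matrices of features. -/
theorem preact_zero (φ : ℝ → ℝ) (w : WeightIdx nin n → ℝ) (x : EuclideanSpace ℝ (Fin nin)) :
    preact φ w x 0 = fun i => inputRows w i ⬝ᵥ inputFeature x := by
  rw [preact, ← Matrix.mulVec_smul]
  rfl

theorem preact_succ (φ : ℝ → ℝ) (w : WeightIdx nin n → ℝ) (x : EuclideanSpace ℝ (Fin nin)) (l : ℕ) :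
    preact φ w x (l + 1) = fun i => hiddenRows l w i ⬝ᵥ feature φ w x l := by
  rw [preact, ← Matrix.mulVec_smul]
  rfl

theorem heConst_nonneg (φ : ℝ → ℝ) : 0 ≤ heConst φ :=
  inv_nonneg.2 (integral_nonneg fun _ => sq_nonneg _)

theorem inputCov_apply {m : ℕ} (x : Fin m → EuclideanSpace ℝ (Fin nin)) (α β : Fin m) :
    inputCov x α β = inputFeature (x α) ⬝ᵥ inputFeature (x β) := by
  rw [inputCov, Matrix.of_apply, inputFeature, inputFeature, smul_dotProduct, dotProduct_smul,
    smul_eq_mul, smul_eq_mul, ← mul_assoc, div_mul_div_comm, one_mul,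
    Real.mul_self_sqrt (Nat.cast_nonneg nin)]
  congr 1
  simp [PiLp.inner_apply, dotProduct, mul_comm]

theorem layerCov_succ {m : ℕ} (φ : ℝ → ℝ) (w : WeightIdx nin n → ℝ)
    (x : Fin m → EuclideanSpace ℝ (Fin nin)) (l : ℕ) (α β : Fin m) :
    layerCov φ w x (l + 1) α β = feature φ w (x α) l ⬝ᵥ feature φ w (x β) l := by
  rw [layerCov, Matrix.of_apply, feature, feature, smul_dotProduct, dotProduct_smul, smul_eq_mul,
    smul_eq_mul, ← mul_assoc,
    Real.mul_self_sqrt (div_nonneg (heConst_nonneg φ) (Nat.cast_nonneg n))]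
  rfl

theorem layerCov_one {m : ℕ} (φ : ℝ → ℝ) (w : WeightIdx nin n → ℝ)
    (x : Fin m → EuclideanSpace ℝ (Fin nin)) (α β : Fin m) :
    layerCov φ w x 1 α β =
      nextCov φ (heConst φ / n) (inputRows w) (inputFeature (x α)) (inputFeature (x β)) := by
  rw [layerCov, Matrix.of_apply, preact_zero, preact_zero]
  rfl

/-- Index shift: features of index `l` have the covariance of index `l + 1` as Gram matrix, and
`hiddenRows l` carries them to the covariance of index `l + 2`. -/
theorem layerCov_succ_succ {m : ℕ} (φ : ℝ → ℝ) (w : WeightIdx nin n → ℝ)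
    (x : Fin m → EuclideanSpace ℝ (Fin nin)) (l : ℕ) (α β : Fin m) :
    layerCov φ w x (l + 2) α β =
      nextCov φ (heConst φ / n) (hiddenRows l w) (feature φ w (x α) l) (feature φ w (x β) l) := by
  rw [layerCov, Matrix.of_apply, preact_succ, preact_succ]
  rfl

theorem measurable_inputRows : Measurable (inputRows : (WeightIdx nin n → ℝ) → _) :=
  measurable_pi_lambda _ fun _ => measurable_pi_lambda _ fun _ => measurable_pi_apply _

theorem measurable_hiddenRows (l : ℕ) : Measurable (hiddenRows l : (WeightIdx nin n → ℝ) → _) :=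
  measurable_pi_lambda _ fun _ => measurable_pi_lambda _ fun _ => measurable_pi_apply _

theorem measurable_preact {φ : ℝ → ℝ} (hφ : Continuous φ) (x : EuclideanSpace ℝ (Fin nin)) (l : ℕ) :
    Measurable fun w : WeightIdx nin n → ℝ => preact φ w x l := by
  induction l with
  | zero =>
    simp only [preact_zero, inputRows, dotProduct]
    fun_prop
  | succ l ih =>
    have hφ' := hφ.measurable
    have h : ∀ j, Measurable fun w : WeightIdx nin n → ℝ => preact φ w x l j :=
      fun j => (measurable_pi_apply j).comp ih
    simp only [preact_succ, hiddenRows, dotProduct, feature, Pi.smul_apply, smul_eq_mul]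
    fun_prop

theorem measurable_feature {φ : ℝ → ℝ} (hφ : Continuous φ) (x : EuclideanSpace ℝ (Fin nin))
    (l : ℕ) : Measurable fun w : WeightIdx nin n → ℝ => feature φ w x l := by
  have hφ' := hφ.measurable
  have h : ∀ j, Measurable fun w : WeightIdx nin n → ℝ => preact φ w x l j :=
    fun j => (measurable_pi_apply j).comp (measurable_preact hφ x l)
  unfold feature
  refine measurable_pi_lambda _ fun j => ?_
  simp only [Pi.smul_apply, smul_eq_mul]
  fun_prop

theorem measurable_layerCov {m : ℕ} {φ : ℝ → ℝ} (hφ : Continuous φ)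
    (x : Fin m → EuclideanSpace ℝ (Fin nin)) (l : ℕ) (α β : Fin m) :
    Measurable fun w : WeightIdx nin n → ℝ => layerCov φ w x l α β := by
  cases l with
  | zero => exact measurable_const
  | succ l =>
    have h : ∀ γ j, Measurable fun w : WeightIdx nin n → ℝ => feature φ w (x γ) l j :=
      fun γ j => (measurable_pi_apply j).comp (measurable_feature hφ (x γ) l)
    simp only [layerCov_succ, dotProduct]
    fun_prop

/-- The weights that the first `l + 1` pre-activations depend on. -/
def pastIdx (nin n l : ℕ) : Finset (WeightIdx nin n) :=
  Finset.disjSum Finset.univ (Finset.range l ×ˢ Finset.univ)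

/-- The weights of a hidden layer. -/
def layerIdx (nin n l : ℕ) : Finset (WeightIdx nin n) :=
  Finset.disjSum ∅ ({l} ×ˢ Finset.univ)

theorem disjoint_pastIdx_layerIdx (l : ℕ) : Disjoint (pastIdx nin n l) (layerIdx nin n l) := by
  rw [Finset.disjoint_left]
  rintro (i | ⟨k, i⟩) h1 h2
  · simp [layerIdx] at h2
  · simp [pastIdx, layerIdx] at h1 h2
    omega

theorem dependsOn_hiddenRows (l : ℕ) :
    DependsOn (hiddenRows l : (WeightIdx nin n → ℝ) → _) (layerIdx nin n l : Set _) := by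
  intro w w' h
  ext i j
  exact h _ (by simp [layerIdx])

theorem dependsOn_preact (φ : ℝ → ℝ) (x : EuclideanSpace ℝ (Fin nin)) {l L : ℕ} (hl : l ≤ L) :
    DependsOn (fun w : WeightIdx nin n → ℝ => preact φ w x l) (pastIdx nin n L : Set _) := by
  intro w w' h
  induction l with
  | zero =>
    have : inputRows w = inputRows w' := by
      ext i j
      exact h _ (by simp [pastIdx])
    simp only [preact_zero, this]
  | succ l ih =>
    have h1 : hiddenRows l w = hiddenRows l w' := by
      ext i j
      refine h _ ?_
      simp [pastIdx]
      omega
    simp only at ih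
    simp only [preact_succ, feature, h1, ih (by omega)]

theorem dependsOn_feature (φ : ℝ → ℝ) (x : EuclideanSpace ℝ (Fin nin)) {l L : ℕ} (hl : l ≤ L) :
    DependsOn (fun w : WeightIdx nin n → ℝ => feature φ w x l) (pastIdx nin n L : Set _) := by
  intro w w' h
  have := dependsOn_preact φ x hl h
  simp only at this
  simp only [feature, this]

theorem dependsOn_layerCov {m : ℕ} (φ : ℝ → ℝ) (x : Fin m → EuclideanSpace ℝ (Fin nin)) {l L : ℕ}
    (hl : l ≤ L + 1) (α β : Fin m) :
    DependsOn (fun w : WeightIdx nin n → ℝ => layerCov φ w x l α β)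
      (pastIdx nin n L : Set _) := by
  intro w w' h
  cases l with
  | zero => rfl
  | succ l =>
    have h1 := dependsOn_feature φ (x α) (Nat.le_of_succ_le_succ hl) h
    have h2 := dependsOn_feature φ (x β) (Nat.le_of_succ_le_succ hl) h
    simp only at h1 h2
    simp only [layerCov_succ, h1, h2]

theorem map_curry_infinitePi_gauss {ι : Type*} {a b : ℕ} {f : Fin a × Fin b → ι}
    (hf : Function.Injective f) :
    (Measure.infinitePi fun _ : ι => gaussianReal 0 1).map
      (fun w (i : Fin a) (j : Fin b) => w (f (i, j))) = gaussMat a b := by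
  have h1 := Measure.map_infinitePi_infinitePi_of_inj (P := fun _ : ι => gaussianReal 0 1) hf
  have h2 := Measure.infinitePi_map_curry (fun (_ : Fin a) (_ : Fin b) => gaussianReal 0 1)
  rw [← h1, Measure.map_map (by fun_prop) (by fun_prop)] at h2
  refine Eq.trans ?_ (h2.trans ?_)
  · rfl
  · simp only [Measure.infinitePi_eq_pi]

theorem map_inputRows : (weightLaw nin n).map inputRows = gaussMat n nin :=
  map_curry_infinitePi_gauss (f := fun q : Fin n × Fin nin => (Sum.inl q : WeightIdx nin n))
    Sum.inl_injective

theorem map_hiddenRows (l : ℕ) : (weightLaw nin n).map (hiddenRows l) = gaussMat n n :=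
  map_curry_infinitePi_gauss (f := fun q : Fin n × Fin n => (Sum.inr (l, q) : WeightIdx nin n))
    fun _ _ h => (Prod.mk.inj (Sum.inr.inj h)).2

/-! ### Stopping at the first large error -/

/-- The sequence `e` stopped when it first reaches `thr`. -/
noncomputable def stopped (thr : ℝ) (e : ℕ → ℝ) : ℕ → ℝ
  | 0 => e 0
  | l + 1 => if thr ≤ stopped thr e l then stopped thr e l else e (l + 1)

theorem stopped_eq_of_lt {thr : ℝ} {e : ℕ → ℝ} {l : ℕ} (h : stopped thr e l < thr) :
    stopped thr e l = e l := by
  cases l with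
  | zero => rfl
  | succ l =>
    rw [stopped] at h ⊢
    split_ifs at h ⊢ with h1
    · exact absurd h1 (not_le.2 h)
    · rfl

/-- Once the threshold is reached the stopped sequence remembers it, so Markov's inequality at the
last layer controls all layers and no maximal inequality is needed. -/
theorem le_stopped {thr : ℝ} {e : ℕ → ℝ} {l L : ℕ} (hl : l ≤ L) (h : thr ≤ e l) :
    thr ≤ stopped thr e L := by
  induction L, hl using Nat.le_induction with
  | base =>
    by_contra hlt
    rw [stopped_eq_of_lt (not_le.1 hlt)] at hlt
    exact hlt h
  | succ L _ ih => rwa [stopped, if_pos ih]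

theorem stopped_congr {thr : ℝ} {e e' : ℕ → ℝ} {l : ℕ} (h : ∀ j ≤ l, e j = e' j) :
    stopped thr e l = stopped thr e' l := by
  induction l with
  | zero => exact h 0 le_rfl
  | succ l ih =>
    rw [stopped, stopped, ih fun j hj => h j (hj.trans (Nat.le_succ l)), h _ le_rfl]

theorem stopped_nonneg {thr : ℝ} {e : ℕ → ℝ} (h : ∀ j, 0 ≤ e j) (l : ℕ) : 0 ≤ stopped thr e l := by
  induction l with
  | zero => exact h 0
  | succ l ih =>
    rw [stopped]
    split_ifs
    exacts [ih, h _]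

theorem measurable_stopped {Ω : Type*} [MeasurableSpace Ω] {thr : ℝ} {e : ℕ → Ω → ℝ}
    (h : ∀ j, Measurable (e j)) (l : ℕ) : Measurable fun ω => stopped thr (fun j => e j ω) l := by
  induction l with
  | zero => exact h 0
  | succ l ih =>
    simp only [stopped]
    exact Measurable.ite (measurableSet_le measurable_const ih) ih (h _)

/-! ### Growth of the expected stopped error -/

/-- The error of the covariance of the pair `(α, β)` in layer `l`. -/
noncomputable def layerErr {m : ℕ} (φ : ℝ → ℝ) (a₀ b₀ : ℝ) (y : ℕ → ℝ)
    (x : Fin m → EuclideanSpace ℝ (Fin nin)) (α β : Fin m) (l : ℕ) (w : WeightIdx nin n → ℝ) : ℝ :=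
  pairErr a₀ b₀ (y l) (layerCov φ w x l α α) (layerCov φ w x l β β) (layerCov φ w x l α β)

theorem measurable_layerErr {m : ℕ} {φ : ℝ → ℝ} (hφ : Continuous φ) (a₀ b₀ : ℝ) (y : ℕ → ℝ)
    (x : Fin m → EuclideanSpace ℝ (Fin nin)) (α β : Fin m) (l : ℕ) :
    Measurable (layerErr φ a₀ b₀ y x α β l : (WeightIdx nin n → ℝ) → ℝ) := by
  have h := fun γ δ => measurable_layerCov (n := n) hφ x l γ δ
  unfold layerErr pairErr
  fun_prop

/-- One-step control of the expected error by the error before. -/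
def StepBound (n : ℕ) (φ : ℝ → ℝ) (r a₀ b₀ : ℝ) (y : ℕ → ℝ) (κ δ : ℝ) : Prop :=
  ∀ (N : ℕ) (u v : Fin N → ℝ) (l : ℕ), pairErr a₀ b₀ (y l) (u ⬝ᵥ u) (v ⬝ᵥ v) (u ⬝ᵥ v) ≤ 1 →
    ∫⁻ M : Fin n → Fin N → ℝ, ENNReal.ofReal (nextErr φ r a₀ b₀ (y (l + 1)) M u v) ∂(gaussMat n N) ≤
      ENNReal.ofReal ((1 + κ) * pairErr a₀ b₀ (y l) (u ⬝ᵥ u) (v ⬝ᵥ v) (u ⬝ᵥ v) + δ)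

/-- The first layer is separate because its rows have length `nin`, which is why `StepBound` allows
every `N`. The initial error is zero. -/
theorem lintegral_stopped_one_le {m : ℕ} {φ : ℝ → ℝ} {y : ℕ → ℝ} {κ δ thr a₀ b₀ : ℝ}
    (x : Fin m → EuclideanSpace ℝ (Fin nin)) (α β : Fin m) (ha : inputCov x α α = a₀)
    (hb : inputCov x β β = b₀) (hy : inputCov x α β = y 0)
    (hstep : StepBound n φ (heConst φ / n) a₀ b₀ y κ δ)
    (hφ : Continuous φ) (hthr : 0 < thr) :
    ∫⁻ w, ENNReal.ofReal (stopped thr (fun j => layerErr φ a₀ b₀ y x α β j w) 1)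
      ∂(weightLaw nin n) ≤ ENNReal.ofReal δ := by
  have h0 : ∀ w : WeightIdx nin n → ℝ, layerErr φ a₀ b₀ y x α β 0 w = 0 := fun w => by
    simp [layerErr, pairErr, layerCov, hy, ha, hb]
  rw [inputCov_apply] at ha hb hy
  set u := inputFeature (x α) with hu
  set v := inputFeature (x β) with hv
  have h0' : pairErr a₀ b₀ (y 0) (u ⬝ᵥ u) (v ⬝ᵥ v) (u ⬝ᵥ v) = 0 := by
    simp [pairErr, hy, ha, hb]
  have h1 : ∀ w : WeightIdx nin n → ℝ, stopped thr (fun j => layerErr φ a₀ b₀ y x α β j w) 1 =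
      nextErr φ (heConst φ / n) a₀ b₀ (y 1) (inputRows w) u v := fun w => by
    rw [stopped, stopped, h0, if_neg (not_le.2 hthr), layerErr, layerCov_one, layerCov_one,
      layerCov_one, nextErr]
  simp_rw [h1]
  have hF : Measurable fun M : Fin n → Fin nin → ℝ =>
      ENNReal.ofReal (nextErr φ (heConst φ / n) a₀ b₀ (y 1) M u v) :=
    ((measurable_nextErr hφ (heConst φ / n) a₀ b₀ (y 1)).comp
      (f := fun M : Fin n → Fin nin → ℝ => (M, u, v)) (by fun_prop)).ennreal_ofReal
  rw [← lintegral_map hF measurable_inputRows, map_inputRows]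
  refine (hstep nin u v 0 (by rw [h0']; exact zero_le_one)).trans_eq ?_
  rw [h0', mul_zero, zero_add]

/-- The features and the stopped error depend only on past weights, so the fresh layer can be
integrated out. If already stopped, the error does not change; otherwise it is below `thr ≤ 1` and
the one-step bound applies. -/
theorem lintegral_stopped_succ_le {m : ℕ} {φ : ℝ → ℝ} {y : ℕ → ℝ} {κ δ thr : ℝ}
    (x : Fin m → EuclideanSpace ℝ (Fin nin)) (α β : Fin m) {a₀ b₀ : ℝ} (hκ : 0 ≤ κ) (hδ : 0 ≤ δ)
    (hstep : StepBound n φ (heConst φ / n) a₀ b₀ y κ δ) (hφ : Continuous φ) (hthr : thr ≤ 1)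
    (l : ℕ) :
    ∫⁻ w, ENNReal.ofReal (stopped thr (fun j => layerErr φ a₀ b₀ y x α β j w) (l + 2))
        ∂(weightLaw nin n) ≤
      ENNReal.ofReal (1 + κ) * (∫⁻ w, ENNReal.ofReal (stopped thr (fun j => layerErr φ a₀ b₀ y x
        α β j w) (l + 1)) ∂(weightLaw nin n)) + ENNReal.ofReal δ := by
  set Y : (WeightIdx nin n → ℝ) → ℝ :=
    fun w => stopped thr (fun j => layerErr φ a₀ b₀ y x α β j w) (l + 1) with hY
  have hYm : Measurable Y := measurable_stopped (fun j => measurable_layerErr hφ a₀ b₀ y x α β j) _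
  have hY0 : ∀ w, 0 ≤ Y w := fun w => stopped_nonneg (fun j => pairErr_nonneg _ _ _ _ _ _) _
  set Z : (WeightIdx nin n → ℝ) → ((Fin n → ℝ) × (Fin n → ℝ)) × ℝ :=
    fun w => ((feature φ w (x α) l, feature φ w (x β) l), Y w) with hZ
  have hZm : Measurable Z :=
    ((measurable_feature hφ (x α) l).prodMk (measurable_feature hφ (x β) l)).prodMk hYm
  have hZd : DependsOn Z (pastIdx nin n l : Set _) := by
    intro w w' h
    have h1 := dependsOn_feature φ (x α) le_rfl h
    have h2 := dependsOn_feature φ (x β) le_rfl h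
    have h3 : Y w = Y w' := stopped_congr fun j hj => by
      have h4 := dependsOn_layerCov φ x hj α α h
      have h5 := dependsOn_layerCov φ x hj β β h
      have h6 := dependsOn_layerCov φ x hj α β h
      simp only at h4 h5 h6
      simp only [layerErr, h4, h5, h6]
    simp only at h1 h2
    simp only [hZ, h1, h2, h3]
  have hind : IndepFun Z (hiddenRows l) (weightLaw nin n) :=
    hZd.indepFun_infinitePi hZm (measurable_hiddenRows l) (dependsOn_hiddenRows l)
      (disjoint_pastIdx_layerIdx l)
  set F : (((Fin n → ℝ) × (Fin n → ℝ)) × ℝ) × (Fin n → Fin n → ℝ) → ENNReal := fun z =>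
    ENNReal.ofReal (if thr ≤ z.1.2 then z.1.2 else
      nextErr φ (heConst φ / n) a₀ b₀ (y (l + 2)) z.2 z.1.1.1 z.1.1.2) with hF
  have hFm : Measurable F := by
    refine (Measurable.ite (measurableSet_le measurable_const (by fun_prop)) (by fun_prop)
      ?_).ennreal_ofReal
    exact (measurable_nextErr hφ _ _ _ _).comp (f := fun z : (((Fin n → ℝ) × (Fin n → ℝ)) × ℝ) ×
      (Fin n → Fin n → ℝ) => (z.2, z.1.1.1, z.1.1.2)) (by fun_prop)
  have he : ∀ w, ENNReal.ofReal (stopped thr (fun j => layerErr φ a₀ b₀ y x α β j w) (l + 2)) =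
      F (Z w, hiddenRows l w) := fun w => by
    rw [stopped]
    simp only [hF, hZ, hY]
    rw [layerErr, layerCov_succ_succ, layerCov_succ_succ, layerCov_succ_succ]
    rfl
  simp_rw [he]
  rw [lintegral_indepFun_eq hZm (measurable_hiddenRows l) hind hFm, map_hiddenRows]
  have hb : ∀ w, ∫⁻ M, F (Z w, M) ∂(gaussMat n n) ≤
      ENNReal.ofReal (1 + κ) * ENNReal.ofReal (Y w) + ENNReal.ofReal δ := fun w => by
    rw [← ENNReal.ofReal_mul (by positivity),
      ← ENNReal.ofReal_add (mul_nonneg (by positivity) (hY0 w)) hδ]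
    simp only [hF, hZ]
    by_cases hthr' : thr ≤ Y w
    · simp only [hthr', if_true]
      rw [lintegral_const, measure_univ, mul_one]
      refine ENNReal.ofReal_le_ofReal ?_
      have := mul_nonneg hκ (hY0 w)
      linarith
    · simp only [hthr', if_false]
      have hYe : Y w = layerErr φ a₀ b₀ y x α β (l + 1) w := stopped_eq_of_lt (not_le.1 hthr')
      rw [layerErr, layerCov_succ, layerCov_succ, layerCov_succ] at hYe
      rw [hYe]
      exact hstep n _ _ (l + 1) (hYe ▸ ((not_le.1 hthr').le.trans hthr))
  refine (lintegral_mono hb).trans_eq ?_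
  rw [lintegral_add_right _ measurable_const, lintegral_const_mul _ hYm.ennreal_ofReal,
    lintegral_const, measure_univ, mul_one]

/-- The probability that the error reaches `thr` within `L` layers. -/
theorem weightLaw_layerErr_le {m : ℕ} {φ : ℝ → ℝ} {y : ℕ → ℝ} {κ δ thr : ℝ}
    (x : Fin m → EuclideanSpace ℝ (Fin nin)) (α β : Fin m) (hy : y 0 = inputCov x α β)
    (hκ : 0 ≤ κ) (hδ : 0 ≤ δ)
    (hstep : StepBound n φ (heConst φ / n) (inputCov x α α) (inputCov x β β) y κ δ)
    (hφ : Continuous φ) (hthr0 : 0 < thr) (hthr : thr ≤ 1) (L : ℕ) :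
    weightLaw nin n {w | ∃ l ≤ L, thr ≤ layerErr φ (inputCov x α α) (inputCov x β β) y x α β l w} ≤
      ENNReal.ofReal (Real.exp (κ * L) * (L * δ) / thr) := by
  set e : ℕ → (WeightIdx nin n → ℝ) → ℝ :=
    fun j w => layerErr φ (inputCov x α α) (inputCov x β β) y x α β j w with he
  -- Discrete Gronwall: `e^(κ l) l δ` dominates the recursion `E' ≤ (1 + κ) E + δ` started at zero,
  -- as `1 + κ ≤ e^κ`.
  have hbound : ∀ l : ℕ, ∫⁻ w, ENNReal.ofReal (stopped thr (fun j => e j w) l) ∂(weightLaw nin n) ≤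
      ENNReal.ofReal (Real.exp (κ * l) * (l * δ)) := by
    intro l
    rcases l with _ | l
    · have h0 : ∀ w, stopped thr (fun j => e j w) 0 = 0 := fun w => by
        simp [stopped, he, layerErr, pairErr, layerCov, hy]
      simp [h0]
    induction l with
    | zero =>
      refine (lintegral_stopped_one_le x α β rfl rfl hy.symm hstep hφ hthr0).trans (ENNReal.ofReal_le_ofReal ?_)
      have : 1 ≤ Real.exp (κ * ((0 + 1 : ℕ) : ℝ)) := Real.one_le_exp (by positivity)
      have := mul_le_mul_of_nonneg_right this hδ
      simpa using this
    | succ l ih =>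
      refine (lintegral_stopped_succ_le x α β hκ hδ hstep hφ hthr l).trans ?_
      refine (add_le_add_left (mul_le_mul_right ih _) _).trans ?_
      rw [← ENNReal.ofReal_mul (by positivity), ← ENNReal.ofReal_add (by positivity) hδ]
      refine ENNReal.ofReal_le_ofReal ?_
      have h1 : 1 + κ ≤ Real.exp κ := by linarith [Real.add_one_le_exp κ]
      have h2 : Real.exp κ * Real.exp (κ * ((l + 1 : ℕ) : ℝ)) =
          Real.exp (κ * ((l + 1 + 1 : ℕ) : ℝ)) := by
        rw [← Real.exp_add]; push_cast; ring_nf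
      have h3 : 1 ≤ Real.exp (κ * ((l + 1 + 1 : ℕ) : ℝ)) := Real.one_le_exp (by positivity)
      have h4 : (1 + κ) * (Real.exp (κ * ((l + 1 : ℕ) : ℝ)) * (((l + 1 : ℕ) : ℝ) * δ)) ≤
          Real.exp (κ * ((l + 1 + 1 : ℕ) : ℝ)) * (((l + 1 : ℕ) : ℝ) * δ) := by
        rw [← h2, ← mul_assoc]
        gcongr
      have h5 := mul_le_mul_of_nonneg_right h3 hδ
      have h6 : (((l + 1 + 1 : ℕ) : ℝ)) = ((l + 1 : ℕ) : ℝ) + 1 := by push_cast; ring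
      calc _ ≤ Real.exp (κ * ((l + 1 + 1 : ℕ) : ℝ)) * (((l + 1 : ℕ) : ℝ) * δ) +
            Real.exp (κ * ((l + 1 + 1 : ℕ) : ℝ)) * δ := by linarith
        _ = Real.exp (κ * ((l + 1 + 1 : ℕ) : ℝ)) * ((((l + 1 : ℕ) : ℝ) + 1) * δ) := by ring
        _ = _ := by rw [← h6]
  have hm : Measurable fun w => ENNReal.ofReal (stopped thr (fun j => e j w) L) :=
    (measurable_stopped (fun j => measurable_layerErr hφ _ _ y x α β j) L).ennreal_ofReal
  have hmarkov := meas_ge_le_lintegral_div (μ := weightLaw nin n) hm.aemeasurable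
    (ε := ENNReal.ofReal thr) (by simpa using hthr0) ENNReal.ofReal_ne_top
  refine (measure_mono ?_).trans (hmarkov.trans ?_)
  · rintro w ⟨l, hl, h⟩
    exact ENNReal.ofReal_le_ofReal (le_stopped (e := fun j => e j w) hl h)
  · rw [ENNReal.ofReal_div_of_pos hthr0]
    exact ENNReal.div_le_div_right (hbound L) _

end Network

/-! ### The limiting flow of a pair -/

/-- The constant `(c₊ - c₋)² / (2π)` of the drift. -/
noncomputable def driftConst (cp cm : ℝ) : ℝ := (cp - cm) ^ 2 / (2 * Real.pi)

theorem driftConst_nonneg (cp cm : ℝ) : 0 ≤ driftConst cp cm := by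
  have := Real.pi_pos
  unfold driftConst
  positivity

theorem lipschitzWith_const_mul_pairDrift {C : ℝ} (hC : 0 ≤ C) (q : ℝ) :
    LipschitzWith ⟨C * Real.pi, mul_nonneg hC Real.pi_pos.le⟩ fun y => C * pairDrift q y :=
  LipschitzWith.of_dist_le_mul fun x y => by
    rw [Real.dist_eq, Real.dist_eq, ← mul_sub, abs_mul, abs_of_nonneg hC]
    exact (mul_le_mul_of_nonneg_left (abs_pairDrift_sub_le q x y) hC).trans_eq
      (mul_assoc _ _ _).symm

theorem abs_const_mul_pairDrift_le {C q : ℝ} (hC : 0 ≤ C) (hq : 0 ≤ q) (y : ℝ) :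
    |C * pairDrift q y| ≤ ((⟨C * (2 * Real.pi * q), mul_nonneg hC
      (mul_nonneg (mul_nonneg zero_le_two Real.pi_pos.le) hq)⟩ : ℝ≥0) : ℝ) := by
  rw [abs_mul, abs_of_nonneg hC]
  exact mul_le_mul_of_nonneg_left (abs_pairDrift_le hq y) hC

/-- `v` solves the scalar equation `v' = C q G(v/q)` on `[0, ∞)` with initial value `c`. -/
def IsPairFlow (C q c : ℝ) (v : ℝ → ℝ) : Prop :=
  v 0 = c ∧ ∀ t, 0 ≤ t → HasDerivWithinAt v (C * pairDrift q (v t)) (Ici 0) t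

theorem exists_isPairFlow {C q : ℝ} (hC : 0 ≤ C) (hq : 0 ≤ q) (c : ℝ) :
    ∃ v, IsPairFlow C q c v :=
  autonomous_exists (lipschitzWith_const_mul_pairDrift hC q) (abs_const_mul_pairDrift_le hC hq) c

theorem IsPairFlow.eqOn {C q c : ℝ} (hC : 0 ≤ C) {v v' : ℝ → ℝ} (h : IsPairFlow C q c v)
    (h' : IsPairFlow C q c v') : EqOn v v' (Ici 0) :=
  autonomous_unique_Ici (lipschitzWith_const_mul_pairDrift hC q) h.2 h'.2 (h.1.trans h'.1.symm)

theorem isPairFlow_const {C q c : ℝ} (h : pairDrift q c = 0) : IsPairFlow C q c fun _ => c :=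
  ⟨rfl, fun t _ => by rw [h, mul_zero]; exact hasDerivWithinAt_const t _ c⟩

theorem IsPairFlow.abs_sub_le {C q c : ℝ} (hC : 0 ≤ C) (hq : 0 ≤ q) {v : ℝ → ℝ}
    (h : IsPairFlow C q c v) {r t : ℝ} (hr : 0 ≤ r) (ht : r ≤ t) :
    |v t - v r| ≤ C * (2 * Real.pi * q) * (t - r) := by
  have hsub : Icc r t ⊆ Ici 0 := fun z hz => hr.trans hz.1
  have := norm_image_sub_le_of_norm_deriv_le_segment' (f := v) (a := r) (b := t)
    (fun z hz => (h.2 z (hsub hz)).mono hsub)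
    (fun z _ => abs_const_mul_pairDrift_le hC hq (v z)) t ⟨ht, le_rfl⟩
  simpa using this

/-- The target is the flow sampled at times `l / s`. The three parts of `δ` are the error of the
rescaled drift coefficient, the Euler error of order `1/s`, and the accumulated variance of order
`s/n`. -/
theorem IsPairFlow.stepBound {nw : ℕ} (hn : nw ≠ 0) {A B : ℝ} (hD : A ^ 2 + B ^ 2 ≠ 0)
    {C a₀ b₀ c s : ℝ} (hC : 0 ≤ C) (ha₀ : 0 < a₀) (hb₀ : 0 < b₀) (hs : 1 ≤ s) {v : ℝ → ℝ}
    (hv : IsPairFlow C √(a₀ * b₀) c v) :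
    StepBound nw (absLin A B) (heConst (absLin A B) / nw) a₀ b₀ (fun l => v (l / s))
      ((2 * driftLip C a₀ b₀ + 1 + 2 * driftLip C a₀ b₀ ^ 2) / s)
      ((3 * (2 * Real.pi * (a₀ + b₀ + 1) * |s * (B ^ 2 / (A ^ 2 + B ^ 2) * (2 / Real.pi)) - C| +
        C * Real.pi * (C * (2 * Real.pi * √(a₀ * b₀))) / s) ^ 2 +
        3 * (((A ^ 2 + B ^ 2)⁻¹) ^ 2 * (|A| + |B|) ^ 4 * gaussFourth * (a₀ + b₀ + 1) ^ 2 *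
          (s / nw))) / s) := by
  have hs0 : 0 < s := by linarith
  intro N u w l hE
  rw [heConst_absLin]
  refine lintegral_nextErr_le hn hD hC ha₀ hb₀ u w hE hs (le_of_eq ?_) ?_ (le_of_eq ?_)
  · rw [eq_div_iff hs0.ne', ← abs_of_pos hs0, ← abs_mul, abs_of_pos hs0]
    congr 1
    field_simp
  · have h := abs_euler_error_le (lipschitzWith_const_mul_pairDrift hC _)
      (abs_const_mul_pairDrift_le hC (Real.sqrt_nonneg (a₀ * b₀))) hv.2 (t := l / s) (h := 1 / s)
      (by positivity) (by positivity)
    have e : (l : ℝ) / s + 1 / s = ((l + 1 : ℕ) : ℝ) / s := by push_cast; ring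
    rw [e] at h
    refine h.trans_eq ?_
    show C * Real.pi * (C * (2 * Real.pi * √(a₀ * b₀))) * (1 / s) ^ 2 = _
    field_simp
  · field_simp

/-! ### Asymptotics of the parameters -/

section Asymptotics

variable {p : ℝ} {n : ℕ → ℕ} {s : ℕ → ℝ}

theorem tendsto_natCast_rpow (hn : Tendsto n atTop atTop) {r : ℝ} (hr : 0 < r) :
    Tendsto (fun k => (n k : ℝ) ^ r) atTop atTop :=
  (tendsto_rpow_atTop hr).comp (tendsto_natCast_atTop_atTop.comp hn)

theorem tendsto_scale_atTop (hp : p ∈ Ioo (0 : ℝ) (1 / 2)) (hn : Tendsto n atTop atTop)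
    (hs : Tendsto (fun k => s k / (n k : ℝ) ^ (2 * p)) atTop (𝓝 1)) : Tendsto s atTop atTop := by
  have hN := tendsto_natCast_rpow hn (show 0 < 2 * p by linarith [hp.1])
  refine (Tendsto.pos_mul_atTop one_pos hs hN).congr' ?_
  filter_upwards [hN.eventually_gt_atTop 0] with k hk
  exact div_mul_cancel₀ _ hk.ne'

/-- Here `p < 1/2` makes the accumulated noise negligible. -/
theorem tendsto_scale_div_width (hp : p ∈ Ioo (0 : ℝ) (1 / 2)) (hn : Tendsto n atTop atTop)
    (hs : Tendsto (fun k => s k / (n k : ℝ) ^ (2 * p)) atTop (𝓝 1)) :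
    Tendsto (fun k => s k / n k) atTop (𝓝 0) := by
  have h1 : Tendsto (fun k => (n k : ℝ) ^ (-(1 - 2 * p))) atTop (𝓝 0) :=
    (tendsto_rpow_neg_atTop (by linarith [hp.2])).comp (tendsto_natCast_atTop_atTop.comp hn)
  have h2 := hs.mul h1
  rw [mul_zero] at h2
  refine h2.congr' ?_
  filter_upwards [hn.eventually_gt_atTop 0] with k hk
  have hk' : (0 : ℝ) < n k := by exact_mod_cast hk
  have e : (n k : ℝ) ^ (-(1 - 2 * p)) = (n k : ℝ) ^ (2 * p) / n k := by
    rw [show -(1 - 2 * p) = 2 * p - 1 by ring, Real.rpow_sub_one hk'.ne']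
  rw [e]
  have := (Real.rpow_pos_of_pos hk' (2 * p)).ne'
  field_simp

theorem tendsto_reluLin (cp cm : ℝ) (hp : p ∈ Ioo (0 : ℝ) (1 / 2)) (hn : Tendsto n atTop atTop) :
    Tendsto (fun k => reluLin cp cm p (n k)) atTop (𝓝 1) := by
  simpa [reluLin] using ((tendsto_natCast_rpow hn hp.1).const_div_atTop ((cp + cm) / 2)).const_add 1

theorem tendsto_reluAbs (cp cm : ℝ) (hp : p ∈ Ioo (0 : ℝ) (1 / 2)) (hn : Tendsto n atTop atTop) :
    Tendsto (fun k => reluAbs cp cm p (n k)) atTop (𝓝 0) :=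
  (tendsto_natCast_rpow hn hp.1).const_div_atTop ((cp - cm) / 2)

theorem tendsto_sq_add_sq (cp cm : ℝ) (hp : p ∈ Ioo (0 : ℝ) (1 / 2))
    (hn : Tendsto n atTop atTop) :
    Tendsto (fun k => reluLin cp cm p (n k) ^ 2 + reluAbs cp cm p (n k) ^ 2) atTop (𝓝 1) := by
  simpa using ((tendsto_reluLin cp cm hp hn).pow 2).add ((tendsto_reluAbs cp cm hp hn).pow 2)

/-- `s B²` tends to `((c₊ - c₋)/2)²`; the factor `2/π` of the arc-cosine formula turns this into
`(c₊ - c₋)²/(2π)`. -/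
theorem tendsto_drift_coefficient (cp cm : ℝ) (hp : p ∈ Ioo (0 : ℝ) (1 / 2))
    (hn : Tendsto n atTop atTop)
    (hs : Tendsto (fun k => s k / (n k : ℝ) ^ (2 * p)) atTop (𝓝 1)) :
    Tendsto (fun k => s k * (reluAbs cp cm p (n k) ^ 2 /
      (reluLin cp cm p (n k) ^ 2 + reluAbs cp cm p (n k) ^ 2) * (2 / Real.pi))) atTop
      (𝓝 (driftConst cp cm)) := by
  have h := ((hs.mul_const (((cp - cm) / 2) ^ 2)).div (tendsto_sq_add_sq cp cm hp hn)
    one_ne_zero).mul_const (2 / Real.pi)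
  have e : 1 * ((cp - cm) / 2) ^ 2 / 1 * (2 / Real.pi) = driftConst cp cm := by
    have := Real.pi_pos.ne'
    unfold driftConst
    field_simp
  rw [e] at h
  refine h.congr fun k => ?_
  have e2 : (n k : ℝ) ^ (2 * p) = ((n k : ℝ) ^ p) ^ 2 := by
    rw [mul_comm, Real.rpow_mul (Nat.cast_nonneg _), Real.rpow_two]
  simp only [Pi.div_apply, e2, reluAbs, div_pow]
  ring

end Asymptotics

/-! ### Convergence of the covariance of a pair -/

/-- Over at most `T s` layers the rates `K/s` and `δ/s` add up to at most `K T` and `T δ`, and `δ →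
0`. -/
theorem tendsto_weightLaw_layerErr {m nin : ℕ} {p : ℝ} {n : ℕ → ℕ} {s : ℕ → ℝ}
    (x : Fin m → EuclideanSpace ℝ (Fin nin)) (cp cm : ℝ) (hp : p ∈ Ioo (0 : ℝ) (1 / 2))
    (hn : Tendsto n atTop atTop)
    (hs : Tendsto (fun k => s k / (n k : ℝ) ^ (2 * p)) atTop (𝓝 1)) (α β : Fin m)
    (ha : 0 < inputCov x α α) (hb : 0 < inputCov x β β) {v : ℝ → ℝ}
    (hv : IsPairFlow (driftConst cp cm) √(inputCov x α α * inputCov x β β) (inputCov x α β) v)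
    {T thr : ℝ} (hT : 0 ≤ T) (hthr0 : 0 < thr) (hthr : thr ≤ 1) :
    Tendsto (fun k => weightLaw nin (n k) {w | ∃ l ≤ ⌊T * s k⌋₊, thr ≤ layerErr
      (shapedReLU cp cm p (n k)) (inputCov x α α) (inputCov x β β) (fun l => v (l / s k)) x α β l w})
      atTop (𝓝 0) := by
  set a₀ := inputCov x α α
  set b₀ := inputCov x β β
  set C := driftConst cp cm
  have hC : 0 ≤ C := driftConst_nonneg cp cm
  set A : ℕ → ℝ := fun k => reluLin cp cm p (n k)
  set B : ℕ → ℝ := fun k => reluAbs cp cm p (n k)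
  set K := 2 * driftLip C a₀ b₀ + 1 + 2 * driftLip C a₀ b₀ ^ 2
  have hK : 0 ≤ K := by have := driftLip_nonneg hC ha hb; positivity
  set δ : ℕ → ℝ := fun k => 3 * (2 * Real.pi * (a₀ + b₀ + 1) *
    |s k * (B k ^ 2 / (A k ^ 2 + B k ^ 2) * (2 / Real.pi)) - C| +
        C * Real.pi * (C * (2 * Real.pi * √(a₀ * b₀))) / s k) ^ 2 +
        3 * (((A k ^ 2 + B k ^ 2)⁻¹) ^ 2 * (|A k| + |B k|) ^ 4 * gaussFourth *
          (a₀ + b₀ + 1) ^ 2 * (s k / n k)) with hδ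
  have hs' := tendsto_scale_atTop hp hn hs
  have hδlim : Tendsto δ atTop (𝓝 0) := by
    have h1 := ((show Tendsto _ _ (𝓝 C) from tendsto_drift_coefficient cp cm hp hn hs).sub_const
      C).abs
    have h2 : Tendsto (fun k => C * Real.pi * (C * (2 * Real.pi * √(a₀ * b₀))) / s k) atTop
      (𝓝 0) := hs'.const_div_atTop _
    have h3 := (((tendsto_sq_add_sq cp cm hp hn).inv₀ one_ne_zero).pow 2).mul
      (((tendsto_reluLin cp cm hp hn).abs.add (tendsto_reluAbs cp cm hp hn).abs).pow 4)
    have h4 := (((h3.mul_const gaussFourth).mul_const ((a₀ + b₀ + 1) ^ 2)).mul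
      (tendsto_scale_div_width hp hn hs)).const_mul 3
    have h5 := ((((h1.const_mul (2 * Real.pi * (a₀ + b₀ + 1))).add h2).pow 2).const_mul 3).add h4
    simpa [hδ, A, B] using h5
  have hlim : Tendsto (fun k => ENNReal.ofReal (Real.exp (K * T) * (T * δ k) / thr)) atTop
      (𝓝 0) := by
    have := ENNReal.tendsto_ofReal (((hδlim.const_mul T).const_mul (Real.exp (K * T))).div_const thr)
    simpa using this
  refine tendsto_of_tendsto_of_tendsto_of_le_of_le' tendsto_const_nhds hlim
    (Eventually.of_forall fun _ => zero_le) ?_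
  filter_upwards [hs'.eventually_ge_atTop 1, hn.eventually_gt_atTop 0,
    (tendsto_sq_add_sq cp cm hp hn).eventually_ne one_ne_zero] with k hk1 hk2 hk3
  have hs0 : 0 < s k := by linarith
  have hδ0 : 0 ≤ δ k := by
    have := gaussFourth_nonneg
    simp only [hδ]
    positivity
  have hstep := hv.stepBound hk2.ne' hk3 hC ha hb hk1
  rw [shapedReLU_eq]
  refine (weightLaw_layerErr_le x α β (by simp [hv.1]) (by positivity) (by positivity) hstep
    (continuous_absLin _ _) hthr0 hthr _).trans (ENNReal.ofReal_le_ofReal ?_)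
  have hL : (⌊T * s k⌋₊ : ℝ) ≤ T * s k := Nat.floor_le (by positivity)
  refine div_le_div_of_nonneg_right (mul_le_mul (Real.exp_le_exp.2 ?_) ?_ (by positivity)
    (Real.exp_nonneg _)) hthr0.le
  · calc K / s k * ⌊T * s k⌋₊ ≤ K / s k * (T * s k) := by gcongr
      _ = K * T := by field_simp
  · calc _ ≤ T * s k * (δ k / s k) := by
          refine mul_le_mul_of_nonneg_right hL (by positivity)
      _ = T * δ k := by field_simp

/-- A zero variance means a zero input feature, and zero features propagate because `φ 0 = 0`. -/
theorem layerCov_eq_zero {m nin n : ℕ} {φ : ℝ → ℝ} (hφ : φ 0 = 0) (w : WeightIdx nin n → ℝ)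
    (x : Fin m → EuclideanSpace ℝ (Fin nin)) {α : Fin m} (h : inputCov x α α = 0) (β : Fin m)
    (l : ℕ) : layerCov φ w x l α β = 0 ∧ layerCov φ w x l β α = 0 := by
  have hu : inputFeature (x α) = 0 := by
    rw [inputCov_apply] at h
    exact dotProduct_self_eq_zero.1 h
  have hf : ∀ l, feature φ w (x α) l = 0 := by
    intro l
    induction l with
    | zero => ext i; simp [feature, preact_zero, hu, hφ]
    | succ l ih =>
      show √(heConst φ / n) • (fun j => φ (preact φ w (x α) (l + 1) j)) = 0
      simp only [preact_succ, ih]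
      ext i
      simp [hφ]
  cases l with
  | zero => constructor <;> simp [layerCov, inputCov_apply, hu]
  | succ l => constructor <;> simp [layerCov_succ, hf]

theorem inputCov_self_nonneg {m nin : ℕ} (x : Fin m → EuclideanSpace ℝ (Fin nin)) (α : Fin m) :
    0 ≤ inputCov x α α := by
  rw [inputCov_apply]
  exact dotProduct_self_nonneg_real _

/-- Uniform convergence in probability of the covariance of a pair of inputs. -/
theorem tendsto_weightLaw_layerCov {m nin : ℕ} {p : ℝ} {n : ℕ → ℕ} {s : ℕ → ℝ}
    (x : Fin m → EuclideanSpace ℝ (Fin nin)) (cp cm : ℝ) (hp : p ∈ Ioo (0 : ℝ) (1 / 2))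
    (hn : Tendsto n atTop atTop)
    (hs : Tendsto (fun k => s k / (n k : ℝ) ^ (2 * p)) atTop (𝓝 1)) (α β : Fin m) {v : ℝ → ℝ}
    (hv : IsPairFlow (driftConst cp cm) √(inputCov x α α * inputCov x β β) (inputCov x α β) v)
    {T ε : ℝ} (hT : 0 ≤ T) (hε : 0 < ε) :
    Tendsto (fun k => weightLaw nin (n k) {w | ∃ l ≤ ⌊T * s k⌋₊,
      ε ≤ |layerCov (shapedReLU cp cm p (n k)) w x l α β - v (l / s k)|}) atTop (𝓝 0) := by
  have hφ0 : ∀ k, shapedReLU cp cm p k 0 = 0 := fun k => by simp [shapedReLU]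
  have hs' := tendsto_scale_atTop hp hn hs
  -- Vanishing variances are treated apart because the Lipschitz constant of the drift requires `a₀
  -- b₀ > 0`; then network and flow are both identically zero.
  have hzero : (∀ k w l, layerCov (n := n k) (shapedReLU cp cm p (n k)) w x l α β = 0) →
      inputCov x α α * inputCov x β β = 0 → inputCov x α β = 0 →
      Tendsto (fun k => weightLaw nin (n k) {w | ∃ l ≤ ⌊T * s k⌋₊,
        ε ≤ |layerCov (shapedReLU cp cm p (n k)) w x l α β - v (l / s k)|}) atTop (𝓝 0) := by
    intro h1 h2 h3
    rw [h2, h3] at hv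
    have hv0 : ∀ t, 0 ≤ t → v t = 0 := fun t ht =>
      hv.eqOn (driftConst_nonneg cp cm) (isPairFlow_const (by simp [pairDrift])) ht
    refine tendsto_const_nhds.congr' ?_
    filter_upwards [hs'.eventually_ge_atTop 0] with k hk
    have : {w : WeightIdx nin (n k) → ℝ | ∃ l ≤ ⌊T * s k⌋₊,
        ε ≤ |layerCov (shapedReLU cp cm p (n k)) w x l α β - v (l / s k)|} = ∅ := by
      refine eq_empty_of_forall_notMem ?_
      rintro w ⟨l, -, hl⟩
      rw [h1, hv0 _ (by positivity), sub_zero, abs_zero] at hl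
      linarith
    rw [this, measure_empty]
  rcases (inputCov_self_nonneg x α).eq_or_lt with ha | ha
  · have h := fun k (w : WeightIdx nin (n k) → ℝ) l => (layerCov_eq_zero (hφ0 (n k)) w x ha.symm β l).1
    exact hzero h (by rw [← ha, zero_mul]) (h 0 0 0)
  rcases (inputCov_self_nonneg x β).eq_or_lt with hb | hb
  · have h := fun k (w : WeightIdx nin (n k) → ℝ) l => (layerCov_eq_zero (hφ0 (n k)) w x hb.symm α l).2
    exact hzero h (by rw [← hb, mul_zero]) (h 0 0 0)
  -- The error is squared, hence `ε²`; the one-step bound requires a threshold of at most `1`.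
  have hthr0 : 0 < min (ε ^ 2) 1 := lt_min (by positivity) one_pos
  refine tendsto_of_tendsto_of_tendsto_of_le_of_le tendsto_const_nhds
    (tendsto_weightLaw_layerErr x cp cm hp hn hs α β ha hb hv hT hthr0 (min_le_right _ _))
    (fun _ => zero_le) fun k => measure_mono ?_
  rintro w ⟨l, hl, h⟩
  refine ⟨l, hl, (min_le_left _ _).trans ?_⟩
  have h2 := pow_le_pow_left₀ hε.le h 2
  rw [sq_abs] at h2
  rw [layerErr, pairErr]
  linarith [sq_nonneg (layerCov (shapedReLU cp cm p (n k)) w x l α α - inputCov x α α),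
    sq_nonneg (layerCov (shapedReLU cp cm p (n k)) w x l β β - inputCov x β β)]

/-! ### Paths in the Skorokhod space -/

theorem IsCadlag.of_continuous {E : Type*} [TopologicalSpace E] {f : ℝ≥0 → E}
    (hf : Continuous f) : IsCadlag f := fun t =>
  ⟨hf.continuousWithinAt, f t, hf.continuousWithinAt (s := Iio t)⟩

theorem SkorokhodSpace.isOpen_iff {E : Type*} [PseudoMetricSpace E] {U : Set (SkorokhodSpace E)} :
    IsOpen U ↔ ∀ f ∈ U, ∃ T ε : ℝ≥0, 0 < ε ∧ f.nbhd T ε ⊆ U := Iff.rfl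

theorem SkorokhodSpace.mem_nbhd_of_forall_dist_lt {E : Type*} [PseudoMetricSpace E]
    {f g : SkorokhodSpace E} {T ε : ℝ≥0} (hε : 0 < ε)
    (h : ∀ t ≤ T, dist (g.1 t) (f.1 t) < ε) : g ∈ f.nbhd T ε :=
  ⟨OrderIso.refl _, fun t => by simpa using hε, h⟩

/-- On `[0,T]` the path visits only finitely many terms of the sequence, so closeness there is open
in the product topology. This yields Borel measurability of the covariance process. -/
theorem continuous_stepPath {E : Type*} [PseudoMetricSpace E] (s : ℝ≥0) :
    Continuous (stepPath s : (ℕ → E) → SkorokhodSpace E) := by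
  refine continuous_def.2 fun U hU => isOpen_iff_mem_nhds.2 fun v hv => ?_
  obtain ⟨T, ε, hε, hsub⟩ := SkorokhodSpace.isOpen_iff.1 hU _ hv
  have h : (Iic ⌊T * s⌋₊).pi (fun l => Metric.ball (v l) (ε : ℝ)) ∈ 𝓝 v :=
    set_pi_mem_nhds (finite_Iic _) fun l _ => Metric.ball_mem_nhds _ (by exact_mod_cast hε)
  filter_upwards [h] with v' hv'
  refine hsub (SkorokhodSpace.mem_nbhd_of_forall_dist_lt hε fun t ht => ?_)
  exact hv' _ (Nat.floor_le_floor (mul_le_mul_left ht s))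

/-- Convergence in probability to a deterministic path implies convergence in distribution. -/
theorem SkorokhodSpace.tendstoInDistribution_const {E : Type*} [PseudoMetricSpace E] {Ω : ℕ → Type*}
    [∀ k, MeasurableSpace (Ω k)] {P : ∀ k, Measure (Ω k)} [∀ k, IsProbabilityMeasure (P k)]
    {X : ∀ k, Ω k → SkorokhodSpace E} (hX : ∀ k, AEMeasurable (X k) (P k)) (v : SkorokhodSpace E)
    (h : ∀ T ε : ℝ≥0, 0 < ε → Tendsto (fun k => P k {ω | X k ω ∉ v.nbhd T ε}) atTop (𝓝 0)) :
    TendstoInDistribution X atTop (fun _ : Unit => v) P (Measure.dirac ()) where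
  forall_aemeasurable := hX
  aemeasurable_limit := aemeasurable_const
  tendsto := by
    -- Portmanteau: only open sets containing `v` matter, and each contains a basic neighbourhood of
    -- `v`.
    refine tendsto_of_forall_isOpen_le_liminf' fun G hG => ?_
    simp only [ProbabilityMeasure.coe_mk]
    rw [Measure.map_apply measurable_const hG.measurableSet]
    by_cases hv : v ∈ G
    · obtain ⟨T, ε, hε, hsub⟩ := isOpen_iff.1 hG v hv
      have hlim : Tendsto (fun k => 1 - P k {ω | X k ω ∉ v.nbhd T ε}) atTop (𝓝 1) := by
        simpa using ENNReal.Tendsto.sub (tendsto_const_nhds (x := (1 : ENNReal))) (h T ε hε)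
          (Or.inl ENNReal.one_ne_top)
      refine prob_le_one.trans (hlim.liminf_eq.symm.le.trans (liminf_le_liminf ?_))
      refine Eventually.of_forall fun k => ?_
      rw [Measure.map_apply_of_aemeasurable (hX k) hG.measurableSet]
      refine tsub_le_iff_right.2 ?_
      rw [← measure_univ (μ := P k)]
      -- Subadditivity suffices, so measurability of the basic neighbourhood plays no role.
      refine (measure_mono fun ω _ => ?_).trans (measure_union_le _ _)
      by_cases hω : X k ω ∈ v.nbhd T ε
      · exact Or.inl (hsub hω)
      · exact Or.inr hω
    · have : (fun _ : Unit => v) ⁻¹' G = ∅ := by ext; simp [hv]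
      rw [this, measure_empty]
      exact zero_le

theorem measurable_covProcess {m nin n : ℕ} (cp cm p : ℝ) (x : Fin m → EuclideanSpace ℝ (Fin nin))
    (s : ℝ≥0) : Measurable (covProcess (n := n) cp cm p x s) := by
  refine (continuous_stepPath s).measurable.comp (measurable_pi_iff.2 fun l => ?_)
  refine measurable_pi_iff.2 fun q => measurable_layerCov ?_ x l _ _
  rw [shapedReLU_eq]
  exact continuous_absLin _ _

/-! ### Covariance matrices of the limit -/

theorem layerCov_posSemidef {m nin n : ℕ} (φ : ℝ → ℝ) (w : WeightIdx nin n → ℝ)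
    (x : Fin m → EuclideanSpace ℝ (Fin nin)) (l : ℕ) : (layerCov φ w x l).PosSemidef := by
  have gram : ∀ {r : ℕ} (u : Fin m → Fin r → ℝ),
      (Matrix.of fun α β => u α ⬝ᵥ u β : Matrix (Fin m) (Fin m) ℝ).PosSemidef := by
    intro r u
    convert Matrix.posSemidef_self_mul_conjTranspose (Matrix.of u) using 1
    ext α β
    simp [Matrix.mul_apply, dotProduct]
  cases l with
  | zero =>
    convert gram fun α => inputFeature (x α) using 1
    ext α β
    exact inputCov_apply x α β
  | succ l =>
    convert gram fun α => feature φ w (x α) l using 1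
    ext α β
    exact layerCov_succ φ w x l α β

theorem Matrix.PosSemidef.of_forall_exists_abs_sub_lt {m : ℕ} {V : Matrix (Fin m) (Fin m) ℝ}
    (h : ∀ ε : ℝ, 0 < ε → ∃ M : Matrix (Fin m) (Fin m) ℝ, M.PosSemidef ∧
      ∀ α β, |M α β - V α β| < ε) : V.PosSemidef := by
  choose M hM hlt using fun j : ℕ => h (1 / (j + 1 : ℝ)) (by positivity)
  have hlim : ∀ α β, Tendsto (fun j => M j α β) atTop (𝓝 (V α β)) := fun α β =>
    tendsto_iff_dist_tendsto_zero.2 (squeeze_zero (fun _ => dist_nonneg)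
      (fun j => (hlt j α β).le) tendsto_one_div_add_atTop_nhds_zero_nat)
  refine Matrix.PosSemidef.of_dotProduct_mulVec_nonneg ?_ fun y => ?_
  · exact Matrix.IsHermitian.ext fun α β => tendsto_nhds_unique (hlim β α)
      ((hlim α β).congr fun j => ((hM j).1.apply α β).symm)
  · have : Tendsto (fun j => star y ⬝ᵥ (M j *ᵥ y)) atTop (𝓝 (star y ⬝ᵥ (V *ᵥ y))) := by
      simp only [dotProduct, Matrix.mulVec]
      exact tendsto_finsetSum _ fun α _ => (tendsto_finsetSum _ fun β _ =>
        (hlim α β).mul_const _).const_mul _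
    exact ge_of_tendsto' this fun j => (hM j).dotProduct_mulVec_nonneg y

/-! ### The scalar flows and the deviation of the network from them -/

/-- The family of pair flows started from the input covariance. -/
def IsCovFlow {m nin : ℕ} (x : Fin m → EuclideanSpace ℝ (Fin nin)) (cp cm : ℝ)
    (V : ℝ → Matrix (Fin m) (Fin m) ℝ) : Prop :=
  ∀ α β, IsPairFlow (driftConst cp cm) √(inputCov x α α * inputCov x β β) (inputCov x α β)
    fun t => V t α β

theorem exists_isCovFlow {m nin : ℕ} (x : Fin m → EuclideanSpace ℝ (Fin nin)) (cp cm : ℝ) :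
    ∃ V, IsCovFlow x cp cm V := by
  choose v hv using fun α β => exists_isPairFlow (driftConst_nonneg cp cm)
    (Real.sqrt_nonneg (inputCov x α α * inputCov x β β)) (inputCov x α β)
  exact ⟨fun t => Matrix.of fun α β => v α β t, hv⟩

/-- A bound on the speed of all the pair flows. -/
noncomputable def covSpeed {m nin : ℕ} (x : Fin m → EuclideanSpace ℝ (Fin nin)) (cp cm : ℝ) : ℝ :=
  ∑ α, ∑ β, driftConst cp cm * (2 * Real.pi * √(inputCov x α α * inputCov x β β))

theorem IsCovFlow.abs_sub_le {m nin : ℕ} {x : Fin m → EuclideanSpace ℝ (Fin nin)} {cp cm : ℝ}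
    {V : ℝ → Matrix (Fin m) (Fin m) ℝ} (hV : IsCovFlow x cp cm V) (α β : Fin m) {r t : ℝ}
    (hr : 0 ≤ r) (ht : r ≤ t) : |V t α β - V r α β| ≤ covSpeed x cp cm * (t - r) := by
  refine ((hV α β).abs_sub_le (driftConst_nonneg cp cm) (Real.sqrt_nonneg _) hr ht).trans
    (mul_le_mul_of_nonneg_right ?_ (sub_nonneg.2 ht))
  have h0 : ∀ γ δ, 0 ≤ driftConst cp cm * (2 * Real.pi * √(inputCov x γ γ * inputCov x δ δ)) :=
    fun γ δ => mul_nonneg (driftConst_nonneg cp cm) (by have := Real.pi_pos; positivity)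
  exact (Finset.single_le_sum (fun δ _ => h0 α δ) (Finset.mem_univ β)).trans
    (Finset.single_le_sum (f := fun γ => ∑ δ, _) (fun γ _ => Finset.sum_nonneg fun δ _ => h0 γ δ)
      (Finset.mem_univ α))

/-- The weights for which some covariance deviates by `ε` from the flow before time `T`. -/
def deviationSet {m nin n : ℕ} (cp cm p : ℝ) (x : Fin m → EuclideanSpace ℝ (Fin nin))
    (V : ℝ → Matrix (Fin m) (Fin m) ℝ) (s T ε : ℝ) : Set (WeightIdx nin n → ℝ) :=
  ⋃ α, ⋃ β, {w | ∃ l ≤ ⌊T * s⌋₊,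
    ε ≤ |layerCov (shapedReLU cp cm p n) w x l α β - V (l / s) α β|}

theorem measurableSet_deviationSet {m nin n : ℕ} (cp cm p : ℝ)
    (x : Fin m → EuclideanSpace ℝ (Fin nin)) (V : ℝ → Matrix (Fin m) (Fin m) ℝ) (s T ε : ℝ) :
    MeasurableSet (deviationSet (n := n) cp cm p x V s T ε) := by
  have hφ : Continuous (shapedReLU cp cm p n) := by
    rw [shapedReLU_eq]
    exact continuous_absLin _ _
  refine .iUnion fun α => .iUnion fun β => ?_
  have h : ∀ l, Measurable fun w : WeightIdx nin n → ℝ =>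
      |layerCov (shapedReLU cp cm p n) w x l α β - V (l / s) α β| := fun l =>
    ((measurable_layerCov hφ x l α β).sub_const _).abs
  measurability

theorem IsCovFlow.tendsto_deviationSet {m nin : ℕ} {x : Fin m → EuclideanSpace ℝ (Fin nin)}
    {cp cm p : ℝ} {V : ℝ → Matrix (Fin m) (Fin m) ℝ} (hV : IsCovFlow x cp cm V)
    (hp : p ∈ Ioo (0 : ℝ) (1 / 2)) {n : ℕ → ℕ} {s : ℕ → ℝ} (hn : Tendsto n atTop atTop)
    (hs : Tendsto (fun k => s k / (n k : ℝ) ^ (2 * p)) atTop (𝓝 1)) {T ε : ℝ} (hT : 0 ≤ T)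
    (hε : 0 < ε) :
    Tendsto (fun k => weightLaw nin (n k) (deviationSet cp cm p x V (s k) T ε)) atTop (𝓝 0) := by
  have h := tendsto_finsetSum Finset.univ fun α _ => tendsto_finsetSum Finset.univ fun β _ =>
    tendsto_weightLaw_layerCov x cp cm hp hn hs α β (hV α β) hT hε
  simp only [Finset.sum_const_zero] at h
  refine tendsto_of_tendsto_of_tendsto_of_le_of_le tendsto_const_nhds h (fun _ => zero_le)
    fun k => ?_
  exact (measure_iUnion_fintype_le _ _).trans (Finset.sum_le_sum fun α _ =>
    measure_iUnion_fintype_le _ _)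

/-- Off the deviation set, the rescaled covariances are close to the flow. -/
theorem IsCovFlow.abs_layerCov_floor_sub_lt {m nin n : ℕ} {x : Fin m → EuclideanSpace ℝ (Fin nin)}
    {cp cm p : ℝ} {V : ℝ → Matrix (Fin m) (Fin m) ℝ} (hV : IsCovFlow x cp cm V) {s T ε : ℝ}
    (hs : 0 < s) (hsε : covSpeed x cp cm * (1 / s) < ε / 2) {w : WeightIdx nin n → ℝ}
    (hw : w ∉ deviationSet cp cm p x V s T (ε / 2)) {t : ℝ} (ht : 0 ≤ t) (htT : t ≤ T)
    (α β : Fin m) :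
    |layerCov (shapedReLU cp cm p n) w x ⌊t * s⌋₊ α β - V t α β| < ε := by
  simp only [deviationSet, mem_iUnion, mem_ofPred_eq, not_exists, not_and, not_le] at hw
  have h1 := hw α β ⌊t * s⌋₊ (Nat.floor_le_floor (mul_le_mul_of_nonneg_right htT hs.le))
  have h2 : (⌊t * s⌋₊ : ℝ) / s ≤ t := (div_le_iff₀ hs).2 (Nat.floor_le (by positivity))
  have h3 : t - (⌊t * s⌋₊ : ℝ) / s ≤ 1 / s := by
    rw [tsub_le_iff_right, ← add_div, le_div_iff₀ hs]
    linarith [Nat.lt_floor_add_one (t * s)]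
  have h4 := hV.abs_sub_le α β (by positivity) h2
  have h0 : 0 ≤ covSpeed x cp cm := Finset.sum_nonneg fun γ _ => Finset.sum_nonneg fun δ _ =>
    mul_nonneg (driftConst_nonneg cp cm) (by have := Real.pi_pos; positivity)
  have h5 := h4.trans (mul_le_mul_of_nonneg_left h3 h0)
  rw [abs_sub_comm] at h5
  linarith [_root_.abs_sub_le (layerCov (shapedReLU cp cm p n) w x ⌊t * s⌋₊ α β)
    (V ((⌊t * s⌋₊ : ℝ) / s) α β) (V t α β)]

theorem eventually_covSpeed_lt {s : ℕ → ℝ} (hs : Tendsto s atTop atTop) (B : ℝ) {ε : ℝ}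
    (hε : 0 < ε) : ∀ᶠ k in atTop, B * (1 / s k) < ε := by
  have h : Tendsto (fun k => B * (1 / s k)) atTop (𝓝 (B * 0)) := by
    simpa only [one_div, Function.comp_def] using (tendsto_inv_atTop_zero.comp hs).const_mul B
  rw [mul_zero] at h
  exact h.eventually_lt_const hε

theorem tendsto_rpow_div_rpow {n : ℕ → ℕ} (hn : Tendsto n atTop atTop) (r : ℝ) :
    Tendsto (fun k => (n k : ℝ) ^ r / (n k : ℝ) ^ r) atTop (𝓝 1) := by
  refine tendsto_const_nhds.congr' ?_
  filter_upwards [hn.eventually_gt_atTop 0] with k hk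
  have : (0 : ℝ) < n k := by exact_mod_cast hk
  rw [div_self (by positivity)]

/-- The flow is an entrywise limit of network covariances, which are Gram matrices; this avoids an
analytic proof that the cone is invariant. -/
theorem IsCovFlow.posSemidef {m nin : ℕ} {x : Fin m → EuclideanSpace ℝ (Fin nin)} {cp cm : ℝ}
    {V : ℝ → Matrix (Fin m) (Fin m) ℝ} (hV : IsCovFlow x cp cm V) {t : ℝ} (ht : 0 ≤ t) :
    (V t).PosSemidef := by
  refine Matrix.PosSemidef.of_forall_exists_abs_sub_lt fun ε hε => ?_
  -- Any exponent in the range serves, since the flow does not depend on `p`.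
  have hp : (1 / 4 : ℝ) ∈ Ioo (0 : ℝ) (1 / 2) := by constructor <;> norm_num
  have hs := tendsto_rpow_div_rpow tendsto_id (2 * (1 / 4))
  have hs' := tendsto_scale_atTop hp tendsto_id hs
  obtain ⟨k, hk, hk0, hkε⟩ := (((hV.tendsto_deviationSet hp tendsto_id hs ht
    (half_pos hε)).eventually_lt_const one_pos).and ((hs'.eventually_gt_atTop 0).and
      (eventually_covSpeed_lt hs' (covSpeed x cp cm) (half_pos hε)))).exists
  -- An event of probability less than one misses some choice of weights.
  obtain ⟨w, hw⟩ : ∃ w, w ∉ deviationSet (nin := nin) (n := id k) cp cm (1 / 4) x V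
      ((id k : ℕ) ^ (2 * (1 / 4 : ℝ))) t (ε / 2) := by
    by_contra! hall
    rw [eq_univ_of_forall hall, measure_univ] at hk
    exact lt_irrefl _ hk
  exact ⟨_, layerCov_posSemidef _ w x _, hV.abs_layerCov_floor_sub_lt hk0 hkε hw ht le_rfl⟩

/-! ### Equivalence of the matrix equation and the scalar flows -/

theorem pairDrift_sqrt_mul_self {a : ℝ} (ha : 0 ≤ a) : pairDrift √(a * a) a = 0 := by
  rw [Real.sqrt_mul_self ha, pairDrift_self]

theorem reluDrift_apply_eq {m : ℕ} (cp cm : ℝ) {V : Matrix (Fin m) (Fin m) ℝ} (hV : V.PosSemidef)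
    (α β : Fin m) :
    reluDrift cp cm V α β = driftConst cp cm * pairDrift √(V α α * V β β) (V α β) :=
  reluDrift_apply cp cm hV α β

theorem IsCovFlow.diag_eq {m nin : ℕ} {x : Fin m → EuclideanSpace ℝ (Fin nin)} {cp cm : ℝ}
    {V : ℝ → Matrix (Fin m) (Fin m) ℝ} (hV : IsCovFlow x cp cm V) (α : Fin m) {t : ℝ}
    (ht : 0 ≤ t) : V t α α = inputCov x α α :=
  (hV α α).eqOn (driftConst_nonneg cp cm)
    (isPairFlow_const (pairDrift_sqrt_mul_self (inputCov_self_nonneg x α))) ht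

theorem IsCovFlow.isCovODESolution {m nin : ℕ} {x : Fin m → EuclideanSpace ℝ (Fin nin)}
    {cp cm : ℝ} {V : ℝ → Matrix (Fin m) (Fin m) ℝ} (hV : IsCovFlow x cp cm V) :
    IsCovODESolution (reluDrift cp cm) (inputCov x) V := by
  refine ⟨Matrix.ext fun α β => (hV α β).1, fun t ht => hV.posSemidef ht, fun t ht α β => ?_⟩
  rw [reluDrift_apply_eq cp cm (hV.posSemidef ht), hV.diag_eq α ht, hV.diag_eq β ht]
  exact (hV α β).2 t ht

/-- The drift vanishes on the diagonal of any positive semidefinite matrix. Every solution thus has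
frozen variances and is a family of scalar flows, which gives uniqueness. -/
theorem IsCovODESolution.diag_eq {m : ℕ} {cp cm : ℝ} {V₀ : Matrix (Fin m) (Fin m) ℝ}
    {U : ℝ → Matrix (Fin m) (Fin m) ℝ} (hU : IsCovODESolution (reluDrift cp cm) V₀ U) (α : Fin m)
    {t : ℝ} (ht : 0 ≤ t) : U t α α = V₀ α α := by
  have hd : ∀ r, 0 ≤ r → HasDerivWithinAt (fun r => U r α α) 0 (Ici 0) r := fun r hr => by
    have h := hU.2.2 r hr α α
    rwa [reluDrift_apply_eq cp cm (hU.2.1 r hr), pairDrift_sqrt_mul_self (hU.2.1 r hr).diag_nonneg,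
      mul_zero] at h
  rw [← hU.1]
  refine (convex_Ici (0 : ℝ)).is_const_of_fderivWithin_eq_zero (𝕜 := ℝ) (f := fun r => U r α α)
    (fun r hr => (hd r hr).differentiableWithinAt) (fun r hr => ?_) ht self_mem_Ici
  have := (hd r hr).hasFDerivWithinAt.fderivWithin (uniqueDiffOn_Ici (0 : ℝ) r hr)
  rw [this]
  ext
  simp

theorem IsCovODESolution.isCovFlow {m nin : ℕ} {x : Fin m → EuclideanSpace ℝ (Fin nin)}
    {cp cm : ℝ} {U : ℝ → Matrix (Fin m) (Fin m) ℝ}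
    (hU : IsCovODESolution (reluDrift cp cm) (inputCov x) U) : IsCovFlow x cp cm U := by
  refine fun α β => ⟨congrFun (congrFun hU.1 α) β, fun t ht => ?_⟩
  have h := hU.2.2 t ht α β
  rwa [reluDrift_apply_eq cp cm (hU.2.1 t ht), hU.diag_eq α ht, hU.diag_eq β ht] at h

theorem IsCovFlow.eqOn {m nin : ℕ} {x : Fin m → EuclideanSpace ℝ (Fin nin)} {cp cm : ℝ}
    {U V : ℝ → Matrix (Fin m) (Fin m) ℝ} (hU : IsCovFlow x cp cm U) (hV : IsCovFlow x cp cm V) :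
    EqOn U V (Ici 0) := fun _ ht =>
  Matrix.ext fun α β => (hU α β).eqOn (driftConst_nonneg cp cm) (hV α β) ht

/-! ### Weak convergence of the covariance process -/

theorem IsCovFlow.continuous_upperEntries {m nin : ℕ} {x : Fin m → EuclideanSpace ℝ (Fin nin)}
    {cp cm : ℝ} {V : ℝ → Matrix (Fin m) (Fin m) ℝ} (hV : IsCovFlow x cp cm V) :
    Continuous fun t : ℝ≥0 => upperEntries (V t) := by
  refine continuous_pi fun q => ?_
  have h : ContinuousOn (fun t : ℝ => V t q.1.1 q.1.2) (Ici 0) := fun t ht =>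
    ((hV q.1.1 q.1.2).2 t ht).continuousWithinAt
  exact h.comp_continuous NNReal.continuous_coe fun t => t.2

theorem NNReal.floor_mul_eq (t s : ℝ≥0) : ⌊t * s⌋₊ = ⌊(t : ℝ) * s⌋₊ := by
  refine (Nat.floor_eq_iff zero_le).2 ⟨?_, ?_⟩
  · exact_mod_cast Nat.floor_le (a := (t : ℝ) * s) (by positivity)
  · exact_mod_cast Nat.lt_floor_add_one ((t : ℝ) * s)

/-- The scale is arbitrary up to `s ~ n^(2p)`, so depth and `n^(2p)` are two instances. Off the
deviation set the path is uniformly close on `[0,T]`, hence in the basic neighbourhood through the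
identity time change. -/
theorem IsCovFlow.tendstoInDistribution {m nin : ℕ} {x : Fin m → EuclideanSpace ℝ (Fin nin)}
    {cp cm p : ℝ} {V : ℝ → Matrix (Fin m) (Fin m) ℝ} (hV : IsCovFlow x cp cm V)
    (hp : p ∈ Ioo (0 : ℝ) (1 / 2)) {n : ℕ → ℕ} {s : ℕ → ℝ≥0} (hn : Tendsto n atTop atTop)
    (hs : Tendsto (fun k => (s k : ℝ) / (n k : ℝ) ^ (2 * p)) atTop (𝓝 1))
    {Ω : ℕ → Type*} [∀ k, MeasurableSpace (Ω k)] (P : ∀ k, Measure (Ω k))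
    [∀ k, IsProbabilityMeasure (P k)] {W : ∀ k, WeightIdx nin (n k) → Ω k → ℝ}
    (hW : ∀ k, IsStdGaussianInit (P k) (W k)) {v : SkorokhodSpace (UpperIdx m → ℝ)}
    (hv : ∀ t : ℝ≥0, v.1 t = upperEntries (V t)) :
    TendstoInDistribution (fun k ω => covProcess cp cm p x (s k) (fun i => W k i ω))
      atTop (fun _ : Unit => v) P (Measure.dirac ()) := by
  refine SkorokhodSpace.tendstoInDistribution_const (fun k =>
    (measurable_covProcess cp cm p x (s k)).comp_aemeasurable (hW k).map_eq.1) v fun T ε hε => ?_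
  have hε' : (0 : ℝ) < ε := by exact_mod_cast hε
  have hs' := tendsto_scale_atTop hp hn hs
  refine tendsto_of_tendsto_of_tendsto_of_le_of_le' tendsto_const_nhds
    (hV.tendsto_deviationSet hp hn hs T.2 (half_pos hε')) (Eventually.of_forall fun _ => zero_le) ?_
  filter_upwards [hs'.eventually_gt_atTop 0,
    eventually_covSpeed_lt hs' (covSpeed x cp cm) (half_pos hε')] with k hk0 hkε
  have hlaw := Measure.map_apply_of_aemeasurable (hW k).map_eq.1
    (measurableSet_deviationSet cp cm p x V (s k) T (ε / 2))
  rw [(hW k).map_eq.2] at hlaw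
  refine le_of_le_of_eq ?_ hlaw.symm
  refine measure_mono fun ω hω => ?_
  by_contra hdev
  refine hω (SkorokhodSpace.mem_nbhd_of_forall_dist_lt hε fun t ht => (dist_pi_lt_iff hε').2
    fun q => ?_)
  rw [hv, Real.dist_eq]
  have := hV.abs_layerCov_floor_sub_lt hk0 hkε hdev t.2 (by exact_mod_cast ht) q.1.1 q.1.2
  rwa [NNReal.val_eq_coe, ← NNReal.floor_mul_eq] at this

theorem mainTheorem1 {m nin : ℕ} (x : Fin m → EuclideanSpace ℝ (Fin nin))
    (cp cm p : ℝ) (hp : p ∈ Ioo (0 : ℝ) (1 / 2))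
    (n d : ℕ → ℕ) (hn : Tendsto n atTop atTop) (hd : Tendsto d atTop atTop)
    (hdn : Tendsto (fun k => (d k : ℝ) / (n k : ℝ) ^ (2 * p)) atTop (𝓝 1))
    {Ω : ℕ → Type*} [∀ k, MeasurableSpace (Ω k)]
    (P : ∀ k, Measure (Ω k)) [∀ k, IsProbabilityMeasure (P k)]
    (W : ∀ k, WeightIdx nin (n k) → Ω k → ℝ) (hW : ∀ k, IsStdGaussianInit (P k) (W k)) :
    (∃ V : ℝ → Matrix (Fin m) (Fin m) ℝ,
      IsCovODESolution (reluDrift cp cm) (inputCov x) V ∧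
      (∀ U, IsCovODESolution (reluDrift cp cm) (inputCov x) U → EqOn U V (Ici 0)) ∧
      ∃ v : SkorokhodSpace (UpperIdx m → ℝ),
        (∀ t : ℝ≥0, v.1 t = upperEntries (V t)) ∧
        TendstoInDistribution
          (fun k ω => covProcess cp cm p x (d k : ℝ≥0) (fun i => W k i ω))
          atTop (fun _ : Unit => v) P (Measure.dirac ()) ∧
        TendstoInDistribution
          (fun k ω => covProcess cp cm p x ((n k : ℝ≥0) ^ (2 * p)) (fun i => W k i ω))
          atTop (fun _ : Unit => v) P (Measure.dirac ())) ∧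
    (∀ V : Matrix (Fin m) (Fin m) ℝ, V.PosSemidef →
      reluDrift cp cm V = (cp - cm) ^ 2 • (resnetDrift V - (1 / 2 : ℝ) • V)) ∧
    ((cp - cm) ^ 2 = 1 → ∀ U : ℝ → Matrix (Fin m) (Fin m) ℝ,
      IsCovODESolution resnetDrift (inputCov x) U ↔
        IsCovODESolution (reluDrift cp cm) (inputCov x) (fun t => Real.exp (-t / 2) • U t)) := by
  obtain ⟨V, hV⟩ := exists_isCovFlow x cp cm
  refine ⟨⟨V, hV.isCovODESolution, fun U hU => hU.isCovFlow.eqOn hV,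
    ⟨_, .of_continuous hV.continuous_upperEntries⟩, fun _ => rfl,
    hV.tendstoInDistribution hp hn (by simpa using hdn) P hW fun _ => rfl,
    hV.tendstoInDistribution hp hn ?_ P hW fun _ => rfl⟩,
    fun V hV => reluDrift_eq cp cm hV, fun hc U => isCovODESolution_exp_smul_iff hc _ U⟩
  simpa using tendsto_rpow_div_rpow hn (2 * p)
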